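/- **Model.** Let $n\ge 1$ and $\omega\in[0,1]$. Clients $1,\dots,n$ are served in order by a single server, and their service times $B_1,\dots,B_n$ are independent, $B_j$ being exponentially distributed with rate $\mu_j\in(0,\infty)$, where $\mu_1,\dots,\mu_n$ are distinct. When client $i<n$ arrives, the time $t\ge 0$ until the arrival of client $i+1$ is chosen as a (measurable) function of the state $(k,u)$ immediately after the arrival of client $i$: $k\in\{1,\dots,i\}$ is the number of clients in the system (clients $i-k+1,\dots,i$), and $u\ge 0$ is the elapsed service time of the client in service. Let $I_j$ be the idle time of the server just before the arrival of client $j$ and $W_j$ the waiting time of client $j$. Let $C_i(k,u)$ denote the infimum over all such dynamic schedules of the expected cost incurred from the arrival of client $i$ on, given that the state immediately after this arrival is $(k,u)$ (so that $B_{i-k+1}$ is conditioned on exceeding $u$); this cost is $\omega\sum_{j=i+1}^n I_j$ plus $(1-\omega)$ times the sum of the remaining waiting times of the $k$ clients present and of $\sum_{j=i+1}^n W_j$. **Notation.** Put time $0$ at the arrival of client $i$, and let $N_s$ be the number of clients in the system at time $s$, the next client arriving at time $t\ge s$. With $\mathbb P_i$ denoting probability given that client $i$ arrived at time $0$ (with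 elapsed service time $u$ of the client in service), put $$f_{ki}(t)=\int_0^t\mathbb P_i(N_s=0\mid N_{0+}=k)\,ds,\qquad g_{ki}(t)=\int_0^t\sum_{\ell=0}^{k-1}(k-\ell-1)\,\mathbb P_i(N_s=k-\ell\mid N_{0+}=k)\,ds,$$ $$p_{k\ell,i}(t)=\mathbb P_i(N_{t+}=\ell\mid N_{0+}=k).$$ Let $\varphi_{k\ell}(s)=\frac{d}{ds}\mathbb P\big(\sum_{j=k}^{k+\ell}B_j\le s\big)$ for $s\ge0$ (right derivative at $s=0$), let $\psi_j(t)=\int_0^te^{-\mu_js}\,ds$, and let $c_{k\ell j}$ ($k\le j\le k+\ell$) be given by $c_{k0k}=\mu_k$, $$c_{k,\ell+1,j}=c_{k\ell j}\frac{\mu_{k+\ell+1}}{\mu_{k+\ell+1}-\mu_j}\ (k\le j\le k+\ell),\qquad c_{k,\ell+1,k+\ell+1}=\sum_{j=k}^{k+\ell}c_{k\ell j}\frac{\mu_{k+\ell+1}}{\mu_j-\mu_{k+\ell+1}}.$$ **Theorem.** For all $k\ge1$, $\ell\ge0$ with $k+\ell\le n$ and all $s\ge0$, the density $\varphi_{k\ell}(s)$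 exists and equals $\sum_{j=k}^{k+\ell}c_{k\ell j}e^{-\mu_js}$. For $1\le k\le i\le n$, $C_i(k,u)$ is finite and does not depend on $u\ge 0$; write $C_i(k)$ for it. Moreover, for every $u\ge0$ and $t\ge 0$, $$f_{ki}(t)=t-\sum_{j=i-k+1}^i\frac{c_{i-k+1,k-1,j}}{\mu_j}\psi_j(t),\qquad g_{ki}(t)=\sum_{\ell=0}^{k-1}(k-\ell-1)\sum_{j=i-k+1}^{i-k+\ell+1}\frac{c_{i-k+1,\ell,j}}{\mu_{i-k+\ell+1}}\psi_j(t),$$ and, if $i<n$, $$p_{k\ell,i}(t)=\frac{\varphi_{i-k+1,k-\ell+1}(t)}{\mu_{i-\ell+2}}\quad(\ell=2,\dots,k+1),\qquad p_{k1,i}(t)=1-\sum_{\ell=2}^{k+1}p_{k\ell,i}(t).$$ The $C_i(k)$ are determined recursively: for $i=1,\dots,n-1$ and $k=1,\dots,i$, $$C_i(k)=\inf_{t\ge0}\Big(\omega f_{ki}(t)+(1-\omega)g_{ki}(t)+\sum_{\ell=1}^{k+1}p_{k\ell,i}(t)\,C_{i+1}(\ell)\Big),$$ whereas, for $k=1,\dots,n$,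 $$C_n(k)=(1-\omega)\,g_{kn}(\infty)=(1-\omega)\sum_{\ell=0}^{k-1}(k-\ell-1)\frac1{\mu_{n-k+\ell+1}},\qquad g_{kn}(\infty):=\lim_{t\to\infty}g_{kn}(t).$$ -/

import Mathlib

open MeasureTheory ProbabilityTheory Set Filter
open scoped ENNReal NNReal Topology

namespace AppointmentScheduling

noncomputable section

/-! ### The queue between two arrivals

Clients `1, …, n` are served in order by a single server; `b j` is the service time of client `j`.
The state immediately after the arrival of client `i` is `(k, u)`: the clients `i-k+1, …, i` are
present, and client `i-k+1` has been in service for `u` time units.  In the following functions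
time `0` is the arrival epoch of client `i`. -/

/-- Time at which the first `m` of the `k` clients present have all completed their service
(for `m = 0` it is `-u`, the time at which the service in progress started). -/
def completion (b : ℕ → ℝ) (i k : ℕ) (u : ℝ) (m : ℕ) : ℝ :=
  (∑ j ∈ Finset.Ioc (i - k) (i - k + m), b j) - u

/-- `N_s`: how many of the `k` clients are still present (including the one in service) at time
`s`, when nobody else has arrived in the meantime. -/
def numPresent (b : ℕ → ℝ) (i k : ℕ) (u s : ℝ) : ℕ :=
  ((Finset.Icc 1 k).filter fun m => s < completion b i k u m).card

/-- Time that the `m`-th of the `k` clients present (`m = 1, …, k`) still has to wait, from time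
`0` on, before its service starts; it is `0` for the client in service. -/
def remainingWait (b : ℕ → ℝ) (i k : ℕ) (u : ℝ) (m : ℕ) : ℝ :=
  max 0 (completion b i k u (m - 1))

/-- Idle time of the server just before the arrival of client `i+1`, if that arrival takes place
at time `t`. -/
def idleTime (b : ℕ → ℝ) (i k : ℕ) (u t : ℝ) : ℝ :=
  max 0 (t - completion b i k u k)

/-- State immediately after the arrival of client `i+1`, if that arrival takes place at time `t`:
the number of clients present, and the elapsed service time of the client in service (which is `0`
if client `i+1` finds the system empty and so enters service at once). -/
def nextState (b : ℕ → ℝ) (i k : ℕ) (u t : ℝ) : ℕ × ℝ :=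
  (numPresent b i k u t + 1,
    if numPresent b i k u t = 0 then 0
    else t - completion b i k u (k - numPresent b i k u t))

/-! ### Dynamic schedules and their cost -/

/-- A dynamic schedule: when client `j` arrives and the state immediately afterwards is `(k, u)`,
client `j+1` is scheduled to arrive `τ j k u` time units later. -/
structure Policy where
  τ : ℕ → ℕ → ℝ → ℝ≥0
  measurable_τ : ∀ j k, Measurable (τ j k)

/-- The state immediately after the arrival of client `i + d`, when the schedule `π` is used from
state `(k, u)` at the arrival of client `i` on. -/
def state (π : Policy) (b : ℕ → ℝ) (i k : ℕ) (u : ℝ) : ℕ → ℕ × ℝ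
  | 0 => (k, u)
  | d + 1 =>
    nextState b (i + d) (state π b i k u d).1 (state π b i k u d).2
      (π.τ (i + d) (state π b i k u d).1 (state π b i k u d).2)

/-- `I_{i+d+1}`: the idle time associated with client `i+d+1`. -/
def clientIdle (π : Policy) (b : ℕ → ℝ) (i k : ℕ) (u : ℝ) (d : ℕ) : ℝ :=
  idleTime b (i + d) (state π b i k u d).1 (state π b i k u d).2
    (π.τ (i + d) (state π b i k u d).1 (state π b i k u d).2)

/-- `W_{i+d}`: the waiting time of client `i+d`, who upon arrival is the last of the clients
present. -/
def clientWait (π : Policy) (b : ℕ → ℝ) (i k : ℕ) (u : ℝ) (d : ℕ) : ℝ :=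
  remainingWait b (i + d) (state π b i k u d).1 (state π b i k u d).2 (state π b i k u d).1

/-- The cost incurred from the arrival of client `i` on: `w` times the idle times associated with
the clients `i+1, …, n`, plus `1 - w` times the waiting still to be done by the `k` clients present
and the waiting times of the clients `i+1, …, n`.  For `i = k = 1`, `u = 0` this is
`w ∑ I_j + (1 - w) ∑ W_j`. -/
def cost (n : ℕ) (w : ℝ) (π : Policy) (b : ℕ → ℝ) (i k : ℕ) (u : ℝ) : ℝ :=
  w * ∑ d ∈ Finset.range (n - i), clientIdle π b i k u d +
    (1 - w) * (∑ m ∈ Finset.Icc 1 k, remainingWait b i k u m +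
      ∑ d ∈ Finset.Icc 1 (n - i), clientWait π b i k u d)

variable {Ω : Type*} [MeasurableSpace Ω]

/-- The law given the state `(k, u)` immediately after the arrival of client `i`: the client in
service, `i-k+1`, is known to have a service time exceeding `u`. -/
def stateLaw (P : Measure Ω) (B : ℕ → Ω → ℝ) (i k : ℕ) (u : ℝ) : Measure Ω :=
  ProbabilityTheory.cond P {x | u < B (i - k + 1) x}

/-- `C_i(k, u)`: the minimal expected cost incurred from the arrival of client `i` on, given the
state `(k, u)` immediately after that arrival. -/
def costToGo (P : Measure Ω) (B : ℕ → Ω → ℝ) (n : ℕ) (w : ℝ) (i k : ℕ) (u : ℝ) : ℝ≥0∞ :=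
  ⨅ π : Policy,
    ∫⁻ x, ENNReal.ofReal (cost n w π (fun j => B j x) i k u) ∂(stateLaw P B i k u)

/-! ### Idle term, waiting term and transition probabilities -/

/-- `f_{ki}(t) = ∫₀ᵗ P_i(N_s = 0 | N_{0+} = k) ds`. -/
def idleTerm (P : Measure Ω) (B : ℕ → Ω → ℝ) (i k : ℕ) (u t : ℝ) : ℝ :=
  ∫ s in (0 : ℝ)..t, (stateLaw P B i k u).real {x | numPresent (fun j => B j x) i k u s = 0}

/-- `g_{ki}(t) = ∫₀ᵗ ∑_{ℓ=0}^{k-1} (k-ℓ-1) P_i(N_s = k-ℓ | N_{0+} = k) ds`. -/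
def waitTerm (P : Measure Ω) (B : ℕ → Ω → ℝ) (i k : ℕ) (u t : ℝ) : ℝ :=
  ∫ s in (0 : ℝ)..t, ∑ ℓ ∈ Finset.range k, ((k : ℝ) - ℓ - 1) *
    (stateLaw P B i k u).real {x | numPresent (fun j => B j x) i k u s = k - ℓ}

/-- `p_{kℓ,i}(t) = P_i(N_{t+} = ℓ | N_{0+} = k)`, where client `i+1` arrives at time `t`. -/
def transProb (P : Measure Ω) (B : ℕ → Ω → ℝ) (i k ℓ : ℕ) (u t : ℝ) : ℝ :=
  (stateLaw P B i k u).real {x | (nextState (fun j => B j x) i k u t).1 = ℓ}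

/-! ### Hypoexponential densities -/

/-- Distribution function of `∑_{j=k}^{k+ℓ} B_j`. -/
def hypoexpCDF (P : Measure Ω) (B : ℕ → Ω → ℝ) (k ℓ : ℕ) (s : ℝ) : ℝ :=
  P.real {x | ∑ j ∈ Finset.Icc k (k + ℓ), B j x ≤ s}

/-- `φ_{kℓ}(s)` for `s ≥ 0`: the density of `∑_{j=k}^{k+ℓ} B_j` (at `s = 0` the derivative is
one-sided). -/
def hypoexpDensity (P : Measure Ω) (B : ℕ → Ω → ℝ) (k ℓ : ℕ) (s : ℝ) : ℝ :=
  derivWithin (hypoexpCDF P B k ℓ) (Ici 0) s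

/-- The coefficients `c_{kℓj}`, `j = k, …, k+ℓ`. -/
def hypoexpCoeff (μ : ℕ → ℝ) (k : ℕ) : ℕ → ℕ → ℝ
  | 0, _ => μ k
  | ℓ + 1, j =>
    if j = k + ℓ + 1 then
      ∑ m ∈ Finset.Icc k (k + ℓ), hypoexpCoeff μ k ℓ m * (μ (k + ℓ + 1) / (μ m - μ (k + ℓ + 1)))
    else hypoexpCoeff μ k ℓ j * (μ (k + ℓ + 1) / (μ (k + ℓ + 1) - μ j))

/-- `ψ_j(t) = ∫₀ᵗ e^{-μ_j s} ds`, with `r = μ_j`. -/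
def expInt (r t : ℝ) : ℝ := ∫ s in (0 : ℝ)..t, Real.exp (-r * s)

end

end AppointmentScheduling

namespace AppointmentScheduling

noncomputable section

/-! ### Hypoexponential phase probabilities -/

/-! Given the state (k,u) after an arrival, lack of memory makes the services still to be completed
look like a fresh start with rates μ_{i-k+1}, μ_{i-k+2}, …, whatever u is
(`stateLaw_completion_le`). The probability that fewer than m of them are over at time s is
`phaseTail`. An induction on m, convolving with one more exponential (`integral_exp_mul_phaseTail`,
`measureReal_sum_le`), identifies it with the explicit mixture of exponentials. Densities,
transition probabilities, f and g are all read off from it.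

That f and g are the expected idle and waiting times accumulated up to time t is the layer-cake
formula (`integral_min_max`), together with a summation by parts (`sum_phaseTail`) that turns waits
counted per client into queue lengths. Letting t tend to infinity gives the terminal cost.

The probabilistic core is the Markov property `lintegral_cost_nextState`. If r clients remain at
time t, the elapsed service time is a function of the services up to client i-r. About the later,
independent services the event says only that the next one exceeds this elapsed time. Freezing the
past therefore leaves exactly the conditional law that defines the cost from the new state.

With the pathwise splitting `cost_succ` this gives a one-step recursion for the expected cost of
each schedule (`expectedCost_succ`). Backward induction then shows that the Bellman solution
`valueFn` is a lower bound for every schedule (`valueFn_le_expectedCost`) and is approached by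
schedules that ignore u (`exists_policy_expectedCost_le`).

All this is done for service times that are nonnegative everywhere. The general case follows by
changing them on a null set (`clampedService`). -/

/-- Probability that a queue whose services have rates `μ a, μ (a+1), …` is in its phase `ℓ`, that
is, has completed exactly `ℓ` services, at time `s`. -/
def phaseProb (μ : ℕ → ℝ) (a ℓ : ℕ) (s : ℝ) : ℝ :=
  (∑ j ∈ Finset.Icc a (a + ℓ), hypoexpCoeff μ a ℓ j * Real.exp (-μ j * s)) / μ (a + ℓ)

/-- Probability that fewer than `m` services are completed at time `s`. -/
def phaseTail (μ : ℕ → ℝ) (a m : ℕ) (s : ℝ) : ℝ :=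
  ∑ ℓ ∈ Finset.range m, phaseProb μ a ℓ s

section Coeff

variable {μ : ℕ → ℝ} {n a ℓ : ℕ}

/-- The new last coefficient is minus the sum of the other new ones, so every linear functional of
the coefficients collapses to differences. This replaces all manipulation of the recursive
definition below, with G an exponential, or an exponential divided by its rate. -/
lemma sum_hypoexpCoeff_succ (μ : ℕ → ℝ) (a ℓ : ℕ) (G : ℕ → ℝ) :
    ∑ j ∈ Finset.Icc a (a + (ℓ + 1)), hypoexpCoeff μ a (ℓ + 1) j * G j =
      ∑ j ∈ Finset.Icc a (a + ℓ), hypoexpCoeff μ a ℓ j *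
        (μ (a + ℓ + 1) / (μ (a + ℓ + 1) - μ j)) * (G j - G (a + ℓ + 1)) := by
  rw [← add_assoc, Finset.sum_Icc_succ_top (by omega)]
  have h1 : ∀ j ∈ Finset.Icc a (a + ℓ), hypoexpCoeff μ a (ℓ + 1) j * G j =
      hypoexpCoeff μ a ℓ j * (μ (a + ℓ + 1) / (μ (a + ℓ + 1) - μ j)) * G j := by
    intro j hj
    have : j ≠ a + ℓ + 1 := by have := Finset.mem_Icc.1 hj; omega
    simp [hypoexpCoeff, this]
  have h2 : hypoexpCoeff μ a (ℓ + 1) (a + ℓ + 1) = ∑ j ∈ Finset.Icc a (a + ℓ),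
      -(hypoexpCoeff μ a ℓ j * (μ (a + ℓ + 1) / (μ (a + ℓ + 1) - μ j))) := by
    rw [hypoexpCoeff, if_pos rfl]
    refine Finset.sum_congr rfl fun j _ => ?_
    rw [← neg_sub (μ (a + ℓ + 1)) (μ j), div_neg, mul_neg]
  rw [Finset.sum_congr rfl h1, h2, Finset.sum_mul, ← Finset.sum_add_distrib]
  refine Finset.sum_congr rfl fun j _ => ?_
  ring

lemma phaseProb_zero (h : μ a ≠ 0) (s : ℝ) : phaseProb μ a 0 s = Real.exp (-μ a * s) := by
  simp [phaseProb, hypoexpCoeff, h]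

lemma rate_mul_phaseProb (h : μ (a + ℓ) ≠ 0) (s : ℝ) :
    μ (a + ℓ) * phaseProb μ a ℓ s =
      ∑ j ∈ Finset.Icc a (a + ℓ), hypoexpCoeff μ a ℓ j * Real.exp (-μ j * s) :=
  mul_div_cancel₀ _ h

lemma phaseProb_succ_at_zero (μ : ℕ → ℝ) (a ℓ : ℕ) : phaseProb μ a (ℓ + 1) 0 = 0 := by
  rw [phaseProb, sum_hypoexpCoeff_succ μ a ℓ fun j => Real.exp (-μ j * 0)]
  simp

lemma phaseTail_succ_at_zero (h : μ a ≠ 0) (m : ℕ) : phaseTail μ a (m + 1) 0 = 1 := by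
  rw [phaseTail, Finset.sum_range_succ']
  simp [phaseProb_succ_at_zero, phaseProb_zero h]

lemma phaseTail_succ (μ : ℕ → ℝ) (a m : ℕ) (s : ℝ) :
    phaseTail μ a (m + 1) s = phaseTail μ a m s + phaseProb μ a m s :=
  Finset.sum_range_succ _ _

lemma continuous_phaseProb (μ : ℕ → ℝ) (a ℓ : ℕ) : Continuous (phaseProb μ a ℓ) := by
  unfold phaseProb
  fun_prop

lemma continuous_phaseTail (μ : ℕ → ℝ) (a m : ℕ) : Continuous (phaseTail μ a m) :=
  continuous_finsetSum _ fun _ _ => continuous_phaseProb _ _ _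

lemma expInt_eq {r : ℝ} (hr : r ≠ 0) (t : ℝ) : expInt r t = (1 - Real.exp (-r * t)) / r := by
  have hd : ∀ x ∈ uIcc (0 : ℝ) t, HasDerivAt (fun x => -(Real.exp (-r * x) / r))
      (Real.exp (-r * x)) x := by
    intro x _
    refine (((hasDerivAt_id x).const_mul (-r)).exp.div_const r).neg.congr_deriv ?_
    simp only [id]
    field_simp
  rw [expInt, intervalIntegral.integral_eq_sub_of_hasDerivAt hd]
  · simp only [mul_zero, Real.exp_zero]
    ring
  · exact Continuous.intervalIntegrable (by fun_prop) _ _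

variable (hpos : ∀ j ∈ Finset.Icc 1 n, 0 < μ j)
  (hdist : ∀ j ∈ Finset.Icc 1 n, ∀ m ∈ Finset.Icc 1 n, μ j = μ m → j = m)
include hpos hdist

/-- After `sum_hypoexpCoeff_succ` the induction step is a partial-fraction identity in each term
separately; distinctness of the rates enters here. The single mixture obtained is what can be
differentiated and normalised. -/
lemma phaseTail_eq (ha : 1 ≤ a) {m : ℕ} (hm : a + m ≤ n) (s : ℝ) :
    phaseTail μ a (m + 1) s =
      ∑ j ∈ Finset.Icc a (a + m), hypoexpCoeff μ a m j * (Real.exp (-μ j * s) / μ j) := by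
  induction m with
  | zero =>
    have : μ a ≠ 0 := (hpos a (Finset.mem_Icc.2 ⟨ha, by omega⟩)).ne'
    simp [phaseTail, phaseProb, hypoexpCoeff, mul_div_assoc]
  | succ m ih =>
    rw [phaseTail_succ, ih (by omega), sum_hypoexpCoeff_succ, phaseProb,
      sum_hypoexpCoeff_succ μ a m fun j => Real.exp (-μ j * s), Finset.sum_div,
      ← Finset.sum_add_distrib]
    refine Finset.sum_congr rfl fun j hj => ?_
    have hj' := Finset.mem_Icc.1 hj
    have hjn : j ∈ Finset.Icc 1 n := Finset.mem_Icc.2 ⟨by omega, by omega⟩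
    have hln : a + m + 1 ∈ Finset.Icc 1 n := Finset.mem_Icc.2 ⟨by omega, by omega⟩
    have h1 : μ j ≠ 0 := (hpos j hjn).ne'
    have h2 : μ (a + m + 1) ≠ 0 := (hpos _ hln).ne'
    have h3 : μ (a + m + 1) - μ j ≠ 0 := fun h => by
      have := hdist _ hln _ hjn (sub_eq_zero.1 h)
      omega
    rw [← add_assoc]
    field_simp
    ring

lemma sum_hypoexpCoeff_div (ha : 1 ≤ a) (hℓ : a + ℓ ≤ n) :
    ∑ j ∈ Finset.Icc a (a + ℓ), hypoexpCoeff μ a ℓ j / μ j = 1 := by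
  have h := phaseTail_eq hpos hdist ha hℓ 0
  rw [phaseTail_succ_at_zero (hpos a (Finset.mem_Icc.2 ⟨ha, by omega⟩)).ne'] at h
  rw [h]
  refine Finset.sum_congr rfl fun j _ => ?_
  simp [div_eq_mul_inv]

/-- The sum is μ (a + m) times `phaseProb μ a m`: the first m + 1 services become complete only by
leaving phase m. -/
lemma hasDerivAt_phaseTail (ha : 1 ≤ a) {m : ℕ} (hm : a + m ≤ n) (s : ℝ) :
    HasDerivAt (phaseTail μ a (m + 1))
      (-∑ j ∈ Finset.Icc a (a + m), hypoexpCoeff μ a m j * Real.exp (-μ j * s)) s := by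
  have h : phaseTail μ a (m + 1) = fun s =>
      ∑ j ∈ Finset.Icc a (a + m), hypoexpCoeff μ a m j * (Real.exp (-μ j * s) / μ j) :=
    funext (phaseTail_eq hpos hdist ha hm)
  rw [h, ← Finset.sum_neg_distrib]
  refine HasDerivAt.fun_sum fun j hj => ?_
  have hj' := Finset.mem_Icc.1 hj
  have h1 : μ j ≠ 0 := (hpos j (Finset.mem_Icc.2 ⟨by omega, by omega⟩)).ne'
  have h2 := (((hasDerivAt_id s).const_mul (-μ j)).exp.div_const (μ j)).const_mul
    (hypoexpCoeff μ a m j)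
  refine h2.congr_deriv ?_
  simp only [id]
  field_simp

/-- The convolution step: the distribution function of `m + 1` phases from that of `m` phases. -/
lemma integral_exp_mul_phaseTail (ha : 1 ≤ a) {m : ℕ} (hm : a + m ≤ n) (s : ℝ) :
    ∫ x in (0 : ℝ)..s, μ (a + m) * Real.exp (-(μ (a + m) * x)) * (1 - phaseTail μ a m (s - x)) =
      1 - phaseTail μ a (m + 1) s := by
  have hμ : μ (a + m) ≠ 0 := (hpos _ (Finset.mem_Icc.2 ⟨by omega, by omega⟩)).ne'
  have hμa : μ a ≠ 0 := (hpos _ (Finset.mem_Icc.2 ⟨by omega, by omega⟩)).ne'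
  -- An antiderivative in closed form: the product rule produces the tail for m + 1 minus the
  -- probability of phase m, which is the tail for m. The boundary term at x = s vanishes because
  -- the tail for m + 1 equals 1 at time 0.
  have hd : ∀ x ∈ uIcc (0 : ℝ) s, HasDerivAt
      (fun x => -(Real.exp (-(μ (a + m) * x)) * (1 - phaseTail μ a (m + 1) (s - x))))
      (μ (a + m) * Real.exp (-(μ (a + m) * x)) * (1 - phaseTail μ a m (s - x))) x := by
    intro x _
    have h1 := ((hasDerivAt_id x).const_mul (μ (a + m))).neg.exp
    have h2 := ((hasDerivAt_phaseTail hpos hdist ha hm (s - x)).comp x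
      ((hasDerivAt_id x).const_sub s)).const_sub 1
    refine (h1.mul h2).neg.congr_deriv ?_
    rw [← rate_mul_phaseProb hμ, Function.comp_apply, phaseTail_succ]
    simp only [Pi.neg_apply, id]
    ring
  rw [intervalIntegral.integral_eq_sub_of_hasDerivAt hd]
  · simp [phaseTail_succ_at_zero hμa]
  · refine Continuous.intervalIntegrable ?_ _ _
    have := continuous_phaseTail μ a m
    fun_prop

end Coeff

/-! ### Sample paths of the queue -/

section Path

variable {b b' : ℕ → ℝ} {n i k m m' r d : ℕ} {u s t w : ℝ} {π : Policy}

lemma completion_mono (hb : ∀ j, 0 ≤ b j) (h : m ≤ m') :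
    completion b i k u m ≤ completion b i k u m' :=
  sub_le_sub_right (Finset.sum_le_sum_of_subset_of_nonneg
    (Finset.Ioc_subset_Ioc_right (by omega)) fun j _ _ => hb j) u

lemma completion_zero : completion b i k u 0 = -u := by simp [completion]

lemma completion_congr (hk : k ≤ i) (h : ∀ j ∈ Finset.Ioc (i - k) i, b j = b' j) (hm : m ≤ k) :
    completion b i k u m = completion b' i k u m := by
  unfold completion
  congr 1
  refine Finset.sum_congr rfl fun j hj => h j ?_
  simp only [Finset.mem_Ioc] at hj ⊢
  omega

lemma numPresent_le : numPresent b i k u s ≤ k := by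
  refine (Finset.card_filter_le _ _).trans ?_
  simp

/-- Completion times increase with m, so the clients still present form a final segment of 1, …, k,
determined by its cardinality. -/
lemma lt_completion_iff (hb : ∀ j, 0 ≤ b j) (h1 : 1 ≤ m) (hm : m ≤ k) :
    s < completion b i k u m ↔ k - m < numPresent b i k u s := by
  constructor
  · intro h
    have hs : Finset.Icc m k ⊆ (Finset.Icc 1 k).filter fun m => s < completion b i k u m := by
      intro j hj
      have hj' := Finset.mem_Icc.1 hj
      exact Finset.mem_filter.2 ⟨Finset.mem_Icc.2 ⟨by omega, hj'.2⟩,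
        h.trans_le (completion_mono hb hj'.1)⟩
    have := Finset.card_le_card hs
    rw [Nat.card_Icc] at this
    unfold numPresent
    omega
  · intro h
    by_contra! hc
    have hs : ((Finset.Icc 1 k).filter fun m => s < completion b i k u m) ⊆ Finset.Ioc m k := by
      intro j hj
      obtain ⟨hj1, hj2⟩ := Finset.mem_filter.1 hj
      refine Finset.mem_Ioc.2 ⟨?_, (Finset.mem_Icc.1 hj1).2⟩
      by_contra! hjm
      exact absurd (hj2.trans_le (completion_mono hb hjm)) (not_lt.2 hc)
    have := Finset.card_le_card hs
    rw [Nat.card_Ioc] at this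
    unfold numPresent at h
    omega

lemma numPresent_eq_zero_iff (hb : ∀ j, 0 ≤ b j) (hk : 1 ≤ k) :
    numPresent b i k u s = 0 ↔ completion b i k u k ≤ s := by
  rw [← not_lt, lt_completion_iff hb hk le_rfl]
  omega

/-- Exactly `m < k` clients have left by time `s ≥ 0`. -/
lemma numPresent_eq_sub_iff (hb : ∀ j, 0 ≤ b j) (hu : 0 ≤ u) (hs : 0 ≤ s) (hm : m < k) :
    numPresent b i k u s = k - m ↔
      completion b i k u m ≤ s ∧ s < completion b i k u (m + 1) := by
  rw [lt_completion_iff hb (by omega) hm]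
  have hle : numPresent b i k u s ≤ k := numPresent_le
  rcases Nat.eq_zero_or_pos m with rfl | h0
  · have : completion b i k u 0 ≤ s := by rw [completion_zero]; linarith
    simp only [this, true_and]
    omega
  · rw [← not_lt, lt_completion_iff hb h0 hm.le]
    omega

lemma numPresent_congr (hk : k ≤ i) (h : ∀ j ∈ Finset.Ioc (i - k) i, b j = b' j) :
    numPresent b i k u s = numPresent b' i k u s := by
  unfold numPresent
  congr 1
  refine Finset.filter_congr fun m hm => ?_
  rw [completion_congr hk h (Finset.mem_Icc.1 hm).2]

lemma remainingWait_congr (hk : k ≤ i) (h : ∀ j ∈ Finset.Ioc (i - k) i, b j = b' j)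
    (hm : m ≤ k) : remainingWait b i k u m = remainingWait b' i k u m := by
  rw [remainingWait, completion_congr hk h (by omega), remainingWait]

lemma idleTime_congr (hk : k ≤ i) (h : ∀ j ∈ Finset.Ioc (i - k) i, b j = b' j) :
    idleTime b i k u t = idleTime b' i k u t := by
  rw [idleTime, completion_congr hk h le_rfl, idleTime]

lemma nextState_congr (hk : k ≤ i) (h : ∀ j ∈ Finset.Ioc (i - k) i, b j = b' j) :
    nextState b i k u t = nextState b' i k u t := by
  rw [nextState, numPresent_congr hk h, completion_congr hk h (Nat.sub_le _ _), nextState]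

lemma nextState_fst_le : (nextState b i k u t).1 ≤ k + 1 :=
  Nat.succ_le_succ numPresent_le

lemma state_fst_le : (state π b i k u d).1 ≤ k + d := by
  induction d with
  | zero => exact le_rfl
  | succ d ih =>
    refine (nextState_fst_le (b := b)).trans ?_
    omega

/-- Each arrival adds at most one client to the count, so the window of clients present never
reaches back beyond client i-k+1. -/
lemma mem_Ioc_of_state {n : ℕ} (hk : k ≤ i) (hd : i + d ≤ n)
    (h : ∀ j ∈ Finset.Ioc (i - k) n, b j = b' j) :
    ∀ j ∈ Finset.Ioc (i + d - (state π b i k u d).1) (i + d), b j = b' j := by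
  intro j hj
  have := state_fst_le (π := π) (b := b) (i := i) (k := k) (u := u) (d := d)
  refine h j ?_
  simp only [Finset.mem_Ioc] at hj ⊢
  omega

lemma state_le (hk : k ≤ i) : (state π b i k u d).1 ≤ i + d :=
  state_fst_le.trans (by omega)

lemma state_congr (hk : k ≤ i) (hd : i + d ≤ n + 1)
    (h : ∀ j ∈ Finset.Ioc (i - k) n, b j = b' j) :
    state π b i k u d = state π b' i k u d := by
  induction d with
  | zero => rfl
  | succ d ih =>
    rw [state, nextState_congr (state_le hk) (mem_Ioc_of_state hk (by omega) h),
      ih (by omega), state]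

/-- The cost from the arrival of client `i` on only involves the services of the clients present
and of those still to come. -/
lemma cost_congr (hk : k ≤ i) (hi : i ≤ n)
    (h : ∀ j ∈ Finset.Ioc (i - k) n, b j = b' j) :
    cost n w π b i k u = cost n w π b' i k u := by
  unfold cost
  have h0 : ∀ j ∈ Finset.Ioc (i - k) i, b j = b' j := fun j hj =>
    h j (Finset.Ioc_subset_Ioc_right hi hj)
  congr 2
  · refine Finset.sum_congr rfl fun d hd => ?_
    have hd' := Finset.mem_range.1 hd
    rw [clientIdle, idleTime_congr (state_le hk) (mem_Ioc_of_state hk (by omega) h),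
      state_congr hk (by omega) h, clientIdle]
  · congr 1
    · exact Finset.sum_congr rfl fun m hm =>
        remainingWait_congr hk h0 (Finset.mem_Icc.1 hm).2
    · refine Finset.sum_congr rfl fun d hd => ?_
      have hd' := Finset.mem_Icc.1 hd
      rw [clientWait, remainingWait_congr (state_le hk) (mem_Ioc_of_state hk (by omega) h) le_rfl,
        state_congr hk (by omega) h, clientWait]

/-! ### One step of the cost recursion -/

/-- The definition of `state` appends a step at the end; dynamic programming needs the first step
peeled off instead. -/
lemma state_succ_eq : state π b i k u (d + 1) =
    state π b (i + 1) (nextState b i k u (π.τ i k u)).1 (nextState b i k u (π.τ i k u)).2 d := by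
  induction d with
  | zero => rfl
  | succ d ih => rw [state, ih, state, show i + (d + 1) = i + 1 + d by omega]

lemma clientIdle_succ : clientIdle π b i k u (d + 1) =
    clientIdle π b (i + 1) (nextState b i k u (π.τ i k u)).1 (nextState b i k u (π.τ i k u)).2 d := by
  rw [clientIdle, state_succ_eq, show i + (d + 1) = i + 1 + d by omega, clientIdle]

lemma clientWait_succ : clientWait π b i k u (d + 1) =
    clientWait π b (i + 1) (nextState b i k u (π.τ i k u)).1 (nextState b i k u (π.τ i k u)).2 d := by
  rw [clientWait, state_succ_eq, show i + (d + 1) = i + 1 + d by omega, clientWait]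

/-- Waiting done during `[0, t]` by the `k` clients present. -/
def waitDuring (b : ℕ → ℝ) (i k : ℕ) (u t : ℝ) : ℝ :=
  ∑ m ∈ Finset.Icc 1 k, min (remainingWait b i k u m) t

/-- Each wait x is min(x, t) plus the excess of x over t. The excess vanishes for clients whose
service has started by time t; for the others it is the wait seen from the next state, whose elapsed
service time absorbs the shift of the origin. -/
lemma sum_remainingWait (hb : ∀ j, 0 ≤ b j) (hk : k ≤ i) (hu : 0 ≤ u) (ht : 0 ≤ t) :
    ∑ m ∈ Finset.Icc 1 k, remainingWait b i k u m = waitDuring b i k u t +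
      ∑ m ∈ Finset.Icc 1 (numPresent b i k u t),
        remainingWait b (i + 1) (nextState b i k u t).1 (nextState b i k u t).2 m := by
  have hle : numPresent b i k u t ≤ k := numPresent_le
  set r := numPresent b i k u t with hr
  have h1 : ∀ m ∈ Finset.Icc 1 k, remainingWait b i k u m =
      min (remainingWait b i k u m) t + max 0 (completion b i k u (m - 1) - t) := by
    intro m _
    unfold remainingWait
    rcases le_total (completion b i k u (m - 1)) t with h | h
    · rw [min_eq_left (max_le ht h), max_eq_left (sub_nonpos.2 h), add_zero]
    · rw [max_eq_right (ht.trans h), min_eq_right h, max_eq_right (sub_nonneg.2 h)]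
      ring
  rw [Finset.sum_congr rfl h1, Finset.sum_add_distrib, waitDuring]
  congr 1
  have h2 : ∑ m ∈ Finset.Icc 1 k, max 0 (completion b i k u (m - 1) - t) =
      ∑ m ∈ Finset.Ioc (k - r) k, max 0 (completion b i k u (m - 1) - t) := by
    refine (Finset.sum_subset (fun m hm => ?_) fun m hm hm' => ?_).symm
    · simp only [Finset.mem_Ioc, Finset.mem_Icc] at hm ⊢
      omega
    · simp only [Finset.mem_Ioc, Finset.mem_Icc] at hm hm'
      refine max_eq_left (sub_nonpos.2 ?_)
      rcases Nat.eq_zero_or_pos (m - 1) with h0 | h0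
      · rw [h0, completion_zero]; linarith
      · rw [← not_lt, lt_completion_iff hb h0 (by omega)]
        omega
  have h3 : ∑ m ∈ Finset.Ioc (k - r) k, max 0 (completion b i k u (m - 1) - t) =
      ∑ m ∈ Finset.Icc 1 r, max 0 (completion b i k u (k - r + m - 1) - t) := by
    refine Finset.sum_bij' (fun m _ => m - (k - r)) (fun m _ => k - r + m) ?_ ?_ ?_ ?_ ?_
    · intro m hm
      simp only [Finset.mem_Ioc, Finset.mem_Icc] at hm ⊢
      omega
    · intro m hm
      simp only [Finset.mem_Ioc, Finset.mem_Icc] at hm ⊢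
      omega
    · intro m hm
      simp only [Finset.mem_Ioc] at hm
      omega
    · intro m hm
      omega
    · intro m hm
      simp only [Finset.mem_Ioc] at hm
      rw [show k - r + (m - (k - r)) = m by omega]
  rw [h2, h3]
  refine Finset.sum_congr rfl fun m hm => ?_
  have hm' := Finset.mem_Icc.1 hm
  have hr0 : r ≠ 0 := by omega
  rw [remainingWait, nextState, ← hr, if_neg hr0]
  congr 1
  simp only [completion]
  rw [show i + 1 - (r + 1) = i - k + (k - r) by omega,
    show i - k + (k - r + m - 1) = i - k + (k - r) + (m - 1) by omega,
    ← Finset.sum_Ioc_consecutive b (show i - k ≤ i - k + (k - r) by omega)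
      (show i - k + (k - r) ≤ i - k + (k - r) + (m - 1) by omega)]
  ring

lemma cost_succ (hb : ∀ j, 0 ≤ b j) (hk : k ≤ i) (hi : i < n) (hu : 0 ≤ u) :
    cost n w π b i k u =
      (w * idleTime b i k u (π.τ i k u) + (1 - w) * waitDuring b i k u (π.τ i k u)) +
      cost n w π b (i + 1) (nextState b i k u (π.τ i k u)).1 (nextState b i k u (π.τ i k u)).2 := by
  obtain ⟨e, rfl⟩ : ∃ e, n = i + 1 + e := ⟨n - (i + 1), by omega⟩
  unfold cost
  rw [show i + 1 + e - i = e + 1 by omega, show i + 1 + e - (i + 1) = e by omega,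
    Finset.sum_range_succ', sum_remainingWait hb hk hu (NNReal.coe_nonneg (π.τ i k u))]
  have hR : ∀ F : ℕ → ℝ, ∑ d ∈ Finset.Icc 1 (e + 1), F d = F 1 + ∑ d ∈ Finset.Icc 1 e, F (d + 1) := by
    intro F
    induction e with
    | zero => simp
    | succ e ih =>
      rw [Finset.sum_Icc_succ_top (by omega), ih (by omega), Finset.sum_Icc_succ_top (by omega),
        add_assoc]
  rw [hR, clientWait_succ]
  simp only [clientIdle_succ, clientWait_succ]
  have h1 : (nextState b i k u (π.τ i k u)).1 = numPresent b i k u (π.τ i k u) + 1 := rfl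
  have h2 := Finset.sum_Icc_succ_top (a := 1) (b := numPresent b i k u (π.τ i k u)) (by omega)
    fun m => remainingWait b (i + 1) (nextState b i k u (π.τ i k u)).1
      (nextState b i k u (π.τ i k u)).2 m
  rw [← h1] at h2
  rw [h2]
  rw [show clientIdle π b i k u 0 = idleTime b i k u (π.τ i k u) from rfl]
  have h3 : clientWait π b (i + 1) (nextState b i k u (π.τ i k u)).1
      (nextState b i k u (π.τ i k u)).2 0 = remainingWait b (i + 1)
        (nextState b i k u (π.τ i k u)).1 (nextState b i k u (π.τ i k u)).2
        (nextState b i k u (π.τ i k u)).1 := rfl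
  rw [h3]
  ring

lemma idleTime_nonneg : 0 ≤ idleTime b i k u t := le_max_left _ _

lemma remainingWait_nonneg : 0 ≤ remainingWait b i k u m := le_max_left _ _

lemma waitDuring_nonneg (ht : 0 ≤ t) : 0 ≤ waitDuring b i k u t :=
  Finset.sum_nonneg fun _ _ => le_min remainingWait_nonneg ht

lemma cost_nonneg (hw : w ∈ Icc (0 : ℝ) 1) : 0 ≤ cost n w π b i k u :=
  add_nonneg (mul_nonneg hw.1 (Finset.sum_nonneg fun _ _ => idleTime_nonneg))
    (mul_nonneg (sub_nonneg.2 hw.2) (add_nonneg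
      (Finset.sum_nonneg fun _ _ => remainingWait_nonneg)
      (Finset.sum_nonneg fun _ _ => remainingWait_nonneg)))

end Path

variable {Ω : Type*} [MeasurableSpace Ω]

/-! ### Measurability -/

section Measurability

variable {n i k m d : ℕ} {w : ℝ}

lemma _root_.Measurable.comp₂ {α β γ δ : Type*} [MeasurableSpace α] [MeasurableSpace β]
    [MeasurableSpace γ] [MeasurableSpace δ] {g : β × γ → δ} (hg : Measurable g) {f : α → β}
    {h : α → γ} (hf : Measurable f) (hh : Measurable h) : Measurable fun a => g (f a, h a) :=
  hg.comp (hf.prodMk hh)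

lemma measurable_completion :
    Measurable fun p : (ℕ → ℝ) × ℝ => completion p.1 i k p.2 m := by
  unfold completion
  fun_prop

lemma measurable_numPresent :
    Measurable fun p : (ℕ → ℝ) × ℝ × ℝ => numPresent p.1 i k p.2.1 p.2.2 := by
  unfold numPresent
  simp only [Finset.card_filter]
  refine Finset.measurable_sum _ fun m _ => Measurable.ite ?_ measurable_const measurable_const
  exact measurableSet_lt measurable_snd.snd
    (measurable_completion.comp₂ measurable_fst measurable_snd.fst)

lemma measurable_natParam {α β : Type*} [MeasurableSpace α] [MeasurableSpace β] {N : α → ℕ}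
    (hN : Measurable N) {F : ℕ → α → β} (hF : ∀ r, Measurable (F r)) :
    Measurable fun a => F (N a) a := by
  have h : Measurable fun q : ℕ × α => F q.1 q.2 := measurable_from_prod_countable_right hF
  exact h.comp (hN.prodMk measurable_id)

lemma measurable_nextState :
    Measurable fun p : (ℕ → ℝ) × ℝ × ℝ => nextState p.1 i k p.2.1 p.2.2 := by
  have hN := measurable_numPresent (i := i) (k := k)
  have h1 : Measurable fun p : (ℕ → ℝ) × ℝ × ℝ => numPresent p.1 i k p.2.1 p.2.2 + 1 :=
    hN.add_const 1
  have h2 := measurable_natParam (F := fun r (p : (ℕ → ℝ) × ℝ × ℝ) =>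
      if r = 0 then (0 : ℝ) else p.2.2 - completion p.1 i k p.2.1 (k - r)) hN fun r =>
    Measurable.ite (MeasurableSet.const _) measurable_const (measurable_snd.snd.sub
      (measurable_completion.comp₂ measurable_fst measurable_snd.fst))
  exact h1.prodMk h2

lemma measurable_nextState_policy (π : Policy) :
    Measurable fun q : ℕ × (ℕ → ℝ) × ℝ => nextState q.2.1 i q.1 q.2.2 (π.τ i q.1 q.2.2) :=
  measurable_from_prod_countable_right fun k => measurable_nextState.comp₂
    measurable_fst (measurable_snd.prodMk
      ((π.measurable_τ i k).comp measurable_snd).coe_nnreal_real)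

lemma measurable_state (π : Policy) :
    Measurable fun p : (ℕ → ℝ) × ℝ => state π p.1 i k p.2 d := by
  induction d with
  | zero => exact measurable_const.prodMk measurable_snd
  | succ d ih =>
    simp only [state]
    exact (measurable_nextState_policy π).comp₂ ih.fst (measurable_fst.prodMk ih.snd)

lemma measurable_remainingWait :
    Measurable fun p : (ℕ → ℝ) × ℝ => remainingWait p.1 i k p.2 m :=
  measurable_const.max measurable_completion

lemma measurable_clientIdle (π : Policy) :
    Measurable fun p : (ℕ → ℝ) × ℝ => clientIdle π p.1 i k p.2 d := by
  have h : Measurable fun q : ℕ × (ℕ → ℝ) × ℝ =>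
      idleTime q.2.1 (i + d) q.1 q.2.2 (π.τ (i + d) q.1 q.2.2) :=
    measurable_from_prod_countable_right fun k => measurable_const.max
      (((π.measurable_τ (i + d) k).comp measurable_snd).coe_nnreal_real.sub measurable_completion)
  have hs := measurable_state π (i := i) (k := k) (d := d)
  exact h.comp₂ hs.fst (measurable_fst.prodMk hs.snd)

lemma measurable_clientWait (π : Policy) :
    Measurable fun p : (ℕ → ℝ) × ℝ => clientWait π p.1 i k p.2 d := by
  have h : Measurable fun q : ℕ × (ℕ → ℝ) × ℝ => remainingWait q.2.1 (i + d) q.1 q.2.2 q.1 :=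
    measurable_from_prod_countable_right fun k => measurable_remainingWait
  have hs := measurable_state π (i := i) (k := k) (d := d)
  exact h.comp₂ hs.fst (measurable_fst.prodMk hs.snd)

lemma measurable_cost (π : Policy) :
    Measurable fun p : (ℕ → ℝ) × ℝ => cost n w π p.1 i k p.2 := by
  have h1 := fun d => measurable_clientIdle π (i := i) (k := k) (d := d)
  have h2 := fun d => measurable_clientWait π (i := i) (k := k) (d := d)
  have h3 := fun m => measurable_remainingWait (i := i) (k := k) (m := m)
  unfold cost
  fun_prop

lemma Measurable.ofReal_cost {α : Type*} [MeasurableSpace α] {b : α → ℕ → ℝ} {u : α → ℝ}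
    (hb : Measurable b) (hu : Measurable u) (π : Policy) :
    Measurable fun a => ENNReal.ofReal (cost n w π (b a) i k (u a)) := by
  exact (measurable_cost (n := n) (i := i) (k := k) (w := w) π).ennreal_ofReal.comp₂ hb hu

end Measurability

/-! ### The Markov property of the embedded states -/

/-- Independent nonnegative service times, those of the clients `1, …, n` being exponential with
distinct rates. -/
structure IsServiceModel (P : Measure Ω) (n : ℕ) (μ : ℕ → ℝ) (B : ℕ → Ω → ℝ) : Prop where
  pos : ∀ j ∈ Finset.Icc 1 n, 0 < μ j
  distinct : ∀ j ∈ Finset.Icc 1 n, ∀ m ∈ Finset.Icc 1 n, μ j = μ m → j = m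
  measurable : ∀ j, Measurable (B j)
  nonneg : ∀ j x, 0 ≤ B j x
  law : ∀ j ∈ Finset.Icc 1 n, P.map (B j) = expMeasure (μ j)
  indep : iIndepFun B P

/-- Expected cost of the schedule `π` from the state `(k, u)` at the arrival of client `i` on. -/
def expectedCost (P : Measure Ω) (B : ℕ → Ω → ℝ) (n : ℕ) (w : ℝ) (π : Policy) (i k : ℕ) (u : ℝ) :
    ℝ≥0∞ :=
  ∫⁻ x, ENNReal.ofReal (cost n w π (fun j => B j x) i k u) ∂(stateLaw P B i k u)

/-- The sequence `b` on `S`, and `0` elsewhere. -/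
def truncSeq (S : Finset ℕ) (b : ℕ → ℝ) (j : ℕ) : ℝ := if j ∈ S then b j else 0

lemma truncSeq_of_mem {S : Finset ℕ} {j : ℕ} (h : j ∈ S) (b : ℕ → ℝ) : truncSeq S b j = b j :=
  if_pos h

section Markov

variable {P : Measure Ω} {B : ℕ → Ω → ℝ} {μ : ℕ → ℝ} {n i k r : ℕ} {u t w : ℝ} {π : Policy}

lemma lintegral_stateLaw (F : Ω → ℝ≥0∞) :
    ∫⁻ x, F x ∂(stateLaw P B i k u) =
      (P {x | u < B (i - k + 1) x})⁻¹ * ∫⁻ x in {x | u < B (i - k + 1) x}, F x ∂P := by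
  rw [stateLaw, ProbabilityTheory.cond, lintegral_smul_measure, smul_eq_mul]

/-- Clearing the denominator makes the identity valid for every u, including those for which the
conditioning event is null; this is the form required by `setLIntegral_frozen`. -/
lemma measure_mul_expectedCost [IsFiniteMeasure P] :
    P {x | u < B (i - k + 1) x} * expectedCost P B n w π i k u =
      ∫⁻ x in {x | u < B (i - k + 1) x}, ENNReal.ofReal (cost n w π (fun j => B j x) i k u) ∂P := by
  rw [expectedCost, lintegral_stateLaw]
  rcases eq_or_ne (P {x | u < B (i - k + 1) x}) 0 with h | h
  · rw [h, zero_mul, Measure.restrict_eq_zero.2 h, lintegral_zero_measure]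
  · rw [← mul_assoc, ENNReal.mul_inv_cancel h (measure_ne_top _ _), one_mul]

lemma lintegral_indepFun {α β : Type*} [MeasurableSpace α] [MeasurableSpace β]
    [IsFiniteMeasure P] {X : Ω → α} {Y : Ω → β} (hX : Measurable X) (hY : Measurable Y)
    (h : IndepFun X Y P) {H : α × β → ℝ≥0∞} (hH : Measurable H) :
    ∫⁻ x, H (X x, Y x) ∂P = ∫⁻ x, ∫⁻ y, H (X x, Y y) ∂P ∂P := by
  have h1 := (indepFun_iff_map_prod_eq_prod_map_map hX.aemeasurable hY.aemeasurable).1 h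
  rw [← lintegral_map (f := H) hH (hX.prodMk hY), h1, lintegral_prod _ hH.aemeasurable,
    lintegral_map hH.lintegral_prod_right' hX]
  refine lintegral_congr fun x => ?_
  rw [lintegral_map (f := fun y => H (X x, y)) (hH.comp measurable_prodMk_left) hY]

lemma measurable_truncSeq (hB : ∀ j, Measurable (B j)) (S : Finset ℕ) :
    Measurable fun x => truncSeq S fun j => B j x := by
  refine measurable_pi_lambda _ fun j => ?_
  unfold truncSeq
  split_ifs
  · exact hB j
  · exact measurable_const

/-- Padding with zeros keeps both blocks of services in the sequence space on which `cost` and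
`completion` are defined. -/
lemma indepFun_truncSeq (hB : ∀ j, Measurable (B j)) (h : iIndepFun B P) {S T : Finset ℕ}
    (hST : Disjoint S T) :
    IndepFun (fun x => truncSeq S fun j => B j x) (fun x => truncSeq T fun j => B j x) P := by
  have key : ∀ S : Finset ℕ, Measurable fun (v : S → ℝ) (j : ℕ) =>
      if hj : j ∈ S then v ⟨j, hj⟩ else 0 := by
    intro S
    refine measurable_pi_lambda _ fun j => ?_
    split_ifs
    · exact measurable_pi_apply _
    · exact measurable_const
  have h1 := (h.indepFun_finset S T hST hB).comp (key S) (key T)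
  convert h1 using 1 <;>
  · funext x j
    simp only [truncSeq, Function.comp_apply]
    split_ifs <;> rfl

lemma measurable_setLIntegral_lt [IsFiniteMeasure P] {c : Ω → ℝ} (hc : Measurable c)
    {G : ℝ × Ω → ℝ≥0∞} (hG : Measurable G) :
    Measurable fun u => ∫⁻ x in {x | u < c x}, G (u, x) ∂P := by
  have hs : MeasurableSet {p : ℝ × Ω | p.1 < c p.2} :=
    measurableSet_lt measurable_fst (hc.comp measurable_snd)
  have h1 := (hG.indicator hs).lintegral_prod_right' (ν := P)
  have h2 : (fun u => ∫⁻ x in {x | u < c x}, G (u, x) ∂P) =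
      fun u => ∫⁻ x, {p : ℝ × Ω | p.1 < c p.2}.indicator G (u, x) ∂P := by
    funext u
    rw [← lintegral_indicator (measurableSet_lt measurable_const hc)]
    rfl
  rw [h2]
  exact h1

/-- Needed because the elapsed time at the next arrival is random and is substituted for u.
Numerator and denominator of the conditional expectation are both parametric integrals. -/
lemma measurable_expectedCost [IsFiniteMeasure P] (hB : ∀ j, Measurable (B j)) :
    Measurable fun u => expectedCost P B n w π i k u := by
  have hb : Measurable fun p : ℝ × Ω => (fun j => B j p.2 : ℕ → ℝ) :=
    measurable_pi_lambda _ fun j => (hB j).comp measurable_snd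
  have h1 := measurable_setLIntegral_lt (P := P) (hB (i - k + 1))
    (Measurable.ofReal_cost (n := n) (i := i) (k := k) (w := w) hb measurable_fst π)
  have h2 := measurable_setLIntegral_lt (P := P) (hB (i - k + 1)) (G := fun _ => 1)
    measurable_const
  simp only [setLIntegral_one] at h2
  unfold expectedCost
  simp_rw [lintegral_stateLaw]
  exact h2.inv.mul h1

/-- Averaging over `Y` given `v X < c Y`, where `X` and `Y` are independent. -/
lemma setLIntegral_frozen {α β : Type*} [MeasurableSpace α] [MeasurableSpace β]
    [IsFiniteMeasure P] {X : Ω → α} {Y : Ω → β} (hX : Measurable X) (hY : Measurable Y)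
    (h : IndepFun X Y P) {A : Set α} (hA : MeasurableSet A) {v : α → ℝ} (hv : Measurable v)
    {c : β → ℝ} (hc : Measurable c) {G : ℝ × β → ℝ≥0∞} (hG : Measurable G)
    {K : ℝ → ℝ≥0∞} (hK : Measurable K)
    (hKG : ∀ u, P {x | u < c (Y x)} * K u = ∫⁻ x in {x | u < c (Y x)}, G (u, Y x) ∂P) :
    ∫⁻ x in {x | X x ∈ A ∧ v (X x) < c (Y x)}, G (v (X x), Y x) ∂P =
      ∫⁻ x in {x | X x ∈ A ∧ v (X x) < c (Y x)}, K (v (X x)) ∂P := by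
  have hE : MeasurableSet {p : α × β | p.1 ∈ A ∧ v p.1 < c p.2} :=
    (measurable_fst hA).inter (measurableSet_lt (hv.comp measurable_fst) (hc.comp measurable_snd))
  have hEx : MeasurableSet {x | X x ∈ A ∧ v (X x) < c (Y x)} :=
    (hX.prodMk hY) hE
  -- Fubini on the event, for an arbitrary integrand. Applied to both sides it reduces the claim to
  -- `hKG` at u = v a for each frozen value a.
  have key : ∀ F : α × β → ℝ≥0∞, Measurable F →
      ∫⁻ x in {x | X x ∈ A ∧ v (X x) < c (Y x)}, F (X x, Y x) ∂P =
        ∫⁻ x, A.indicator (fun a => ∫⁻ y in {y | v a < c (Y y)}, F (a, Y y) ∂P) (X x) ∂P := by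
    intro F hF
    have h1 := lintegral_indepFun hX hY h (hF.indicator hE)
    rw [← lintegral_indicator hEx]
    refine Eq.trans (lintegral_congr fun x => ?_) (h1.trans (lintegral_congr fun x => ?_))
    · rfl
    · by_cases hx : X x ∈ A
      · have hs : MeasurableSet {y | v (X x) < c (Y y)} :=
          measurableSet_lt measurable_const (hc.comp hY)
        rw [indicator_of_mem hx, ← lintegral_indicator hs]
        refine lintegral_congr fun y => ?_
        simp [indicator, hx]
      · rw [indicator_of_notMem hx, ← lintegral_zero (μ := P)]
        refine lintegral_congr fun y => ?_
        simp [hx]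
  rw [key (fun p => G (v p.1, p.2)) (hG.comp ((hv.comp measurable_fst).prodMk measurable_snd)),
    key (fun p => K (v p.1)) (hK.comp (hv.comp measurable_fst))]
  congr 1 with x
  congr 1 with a
  dsimp only
  rw [← hKG, setLIntegral_const, mul_comm]

/-- Averaging the cost over the services that are still to be completed, the elapsed service time
being a function of the earlier ones. -/
lemma setLIntegral_cost_frozen [IsFiniteMeasure P] (hB : ∀ j, Measurable (B j))
    (hind : iIndepFun B P) (hr : r ≤ i) (hi : i < n) {A : Set (ℕ → ℝ)} (hA : MeasurableSet A)
    {v : (ℕ → ℝ) → ℝ} (hv : Measurable v) {X : Ω → ℕ → ℝ}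
    (hX : X = fun x => truncSeq (Finset.Iic (i - r)) fun j => B j x) :
    ∫⁻ x in {x | X x ∈ A ∧ v (X x) < B (i - r + 1) x},
        ENNReal.ofReal (cost n w π (fun j => B j x) (i + 1) (r + 1) (v (X x))) ∂P =
      ∫⁻ x in {x | X x ∈ A ∧ v (X x) < B (i - r + 1) x},
        expectedCost P B n w π (i + 1) (r + 1) (v (X x)) ∂P := by
  have hXm : Measurable X := hX ▸ measurable_truncSeq hB _
  have hYm := measurable_truncSeq hB (Finset.Ioc (i - r) n)
  have hXY : IndepFun X (fun x => truncSeq (Finset.Ioc (i - r) n) fun j => B j x) P := by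
    rw [hX]
    refine indepFun_truncSeq hB hind (Finset.disjoint_left.2 fun j hj hj' => ?_)
    simp only [Finset.mem_Iic, Finset.mem_Ioc] at hj hj'
    omega
  have hir : i + 1 - (r + 1) = i - r := by omega
  have hYc : ∀ x, truncSeq (Finset.Ioc (i - r) n) (fun j => B j x) (i - r + 1) =
      B (i - r + 1) x := fun x =>
    truncSeq_of_mem (Finset.mem_Ioc.2 ⟨by omega, by omega⟩) _
  have hYcost : ∀ x v, cost n w π (truncSeq (Finset.Ioc (i - r) n) fun j => B j x) (i + 1)
      (r + 1) v = cost n w π (fun j => B j x) (i + 1) (r + 1) v := by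
    intro x v
    refine cost_congr (by omega) hi fun j hj => ?_
    rw [hir] at hj
    exact truncSeq_of_mem hj _
  have h1 := setLIntegral_frozen hXm hYm hXY hA hv (measurable_pi_apply (i - r + 1))
    (G := fun p => ENNReal.ofReal (cost n w π p.2 (i + 1) (r + 1) p.1))
    (Measurable.ofReal_cost measurable_snd measurable_fst π)
    (measurable_expectedCost hB (n := n) (w := w) (π := π) (i := i + 1) (k := r + 1)) (by
      intro u
      simp only [hYc, hYcost]
      have h := measure_mul_expectedCost (P := P) (B := B) (n := n) (w := w) (π := π)
        (i := i + 1) (k := r + 1) (u := u)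
      rw [hir] at h
      exact h)
  simp only [hYc, hYcost] at h1
  exact h1

/-- Strict positivity matters when the next client finds the server idle: the elapsed time is then 0
and the conditioning event 0 < B must have full measure. -/
lemma ae_pos_of_map_eq_expMeasure {X : Ω → ℝ} {r : ℝ} (hr : 0 < r) (hX : Measurable X)
    (h : P.map X = expMeasure r) : ∀ᵐ x ∂P, 0 < X x := by
  have := isProbabilityMeasure_expMeasure hr
  have h1 : expMeasure r (Iic 0) = 0 := by
    have h2 := cdf_expMeasure_eq hr 0
    rw [cdf_eq_real] at h2
    simpa [Measure.real, ENNReal.toReal_eq_zero_iff] using h2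
  rw [← h, Measure.map_apply hX measurableSet_Iic] at h1
  rw [ae_iff]
  exact measure_mono_null (fun x hx => not_lt.1 hx) h1

/-- Given the state immediately after the arrival of client `i`, the cost incurred from the arrival
of client `i + 1` on has the law prescribed by the state found then. -/
theorem lintegral_cost_nextState [IsProbabilityMeasure P] (hM : IsServiceModel P n μ B)
    (hk1 : 1 ≤ k) (hk : k ≤ i) (hi : i < n) (hu : 0 ≤ u) (ht : 0 ≤ t) :
    ∫⁻ x, ENNReal.ofReal (cost n w π (fun j => B j x) (i + 1)
        (nextState (fun j => B j x) i k u t).1 (nextState (fun j => B j x) i k u t).2)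
        ∂(stateLaw P B i k u) =
      ∫⁻ x, expectedCost P B n w π (i + 1)
        (nextState (fun j => B j x) i k u t).1 (nextState (fun j => B j x) i k u t).2
        ∂(stateLaw P B i k u) := by
  rw [lintegral_stateLaw, lintegral_stateLaw]
  congr 1
  have hBm : Measurable fun x j => B j x := measurable_pi_lambda _ hM.measurable
  have hN : Measurable fun x => numPresent (fun j => B j x) i k u t :=
    measurable_numPresent.comp (hBm.prodMk (measurable_const (a := (u, t))))
  have hU : (⋃ r ∈ Finset.range (k + 1), {x | numPresent (fun j => B j x) i k u t = r}) = univ := by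
    refine eq_univ_of_forall fun x => ?_
    simp only [mem_iUnion, mem_ofPred_eq, Finset.mem_range]
    exact ⟨_, Nat.lt_succ_of_le numPresent_le, rfl⟩
  rw [← setLIntegral_univ, ← setLIntegral_univ (μ := P.restrict _), ← hU]
  have hdisj : PairwiseDisjoint (↑(Finset.range (k + 1)))
      fun r => {x | numPresent (fun j => B j x) i k u t = r} := fun r _ r' _ hrr =>
    disjoint_left.2 fun x hx hx' => hrr (hx.symm.trans hx')
  have hms : ∀ r, MeasurableSet {x | numPresent (fun j => B j x) i k u t = r} := fun r =>
    hN (measurableSet_singleton r)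
  rw [lintegral_biUnion_finset hdisj fun r _ => hms r,
    lintegral_biUnion_finset hdisj fun r _ => hms r]
  refine Finset.sum_congr rfl fun r hr => ?_
  have hrk : r ≤ k := Nat.lt_succ_iff.1 (Finset.mem_range.1 hr)
  rw [Measure.restrict_restrict (hms r)]
  set v : (ℕ → ℝ) → ℝ := fun b => if r = 0 then 0 else t - completion b i k u (k - r) with hv
  have hvm : Measurable v := by
    refine Measurable.ite (MeasurableSet.const _) measurable_const (measurable_const.sub ?_)
    exact measurable_completion.comp₂ measurable_id measurable_const
  -- `A` may involve only services up to client i-r. If r = k, the service conditioned to exceed u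
  -- is the one still running, hence the guard r < k; in that case u < B follows from v = t + u < B.
  set A : Set (ℕ → ℝ) := {b | (r < k → u < b (i - k + 1)) ∧ completion b i k u (k - r) ≤ t} with hA
  have hAm : MeasurableSet A := by
    have h1 : MeasurableSet {b : ℕ → ℝ | r < k → u < b (i - k + 1)} := by
      by_cases h : r < k
      · simp only [h, forall_true_left]
        exact measurableSet_lt measurable_const (measurable_pi_apply (i - k + 1))
      · simp [h]
    exact h1.inter (measurableSet_le
      (measurable_completion.comp₂ measurable_id measurable_const) measurable_const)
  have hc : ∀ x, completion (truncSeq (Finset.Iic (i - r)) fun j => B j x) i k u (k - r) =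
      completion (fun j => B j x) i k u (k - r) := by
    intro x
    unfold completion
    congr 1
    refine Finset.sum_congr rfl fun j hj => truncSeq_of_mem ?_ _
    simp only [Finset.mem_Ioc, Finset.mem_Iic] at hj ⊢
    omega
  have hb : ∀ x, r < k →
      truncSeq (Finset.Iic (i - r)) (fun j => B j x) (i - k + 1) = B (i - k + 1) x := by
    intro x h
    exact truncSeq_of_mem (Finset.mem_Iic.2 (by omega)) _
  -- The event splits into a condition on the past and one inequality for the service in progress.
  -- Equality is only almost sure because for r = 0 that inequality, 0 < B for client i+1, is not
  -- part of the left side.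
  have hS : ({x | numPresent (fun j => B j x) i k u t = r} ∩ {x | u < B (i - k + 1) x} : Set Ω)
      =ᵐ[P] {x | (truncSeq (Finset.Iic (i - r)) fun j => B j x) ∈ A ∧
        v (truncSeq (Finset.Iic (i - r)) fun j => B j x) < B (i - r + 1) x} := by
    have hj : i - r + 1 ∈ Finset.Icc 1 n := Finset.mem_Icc.2 ⟨by omega, by omega⟩
    have hpos := ae_pos_of_map_eq_expMeasure (hM.pos _ hj) (hM.measurable _) (hM.law _ hj)
    filter_upwards [hpos] with x hx
    refine propext ?_
    change (numPresent (fun j => B j x) i k u t = r ∧ u < B (i - k + 1) x) ↔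
      ((r < k → u < truncSeq (Finset.Iic (i - r)) (fun j => B j x) (i - k + 1)) ∧
      completion (truncSeq (Finset.Iic (i - r)) fun j => B j x) i k u (k - r) ≤ t) ∧
      (if r = 0 then 0 else t - completion (truncSeq (Finset.Iic (i - r)) fun j => B j x) i k u
        (k - r)) < B (i - r + 1) x
    rw [hc]
    have hbx : ∀ j, 0 ≤ (fun j => B j x) j := fun j => hM.nonneg j x
    rcases Nat.eq_zero_or_pos r with rfl | hr0
    · simp only [if_true, hx, and_true]
      rw [numPresent_eq_zero_iff hbx hk1, hb x (by omega)]
      simp only [Nat.sub_zero, Nat.lt_of_lt_of_le Nat.zero_lt_one hk1, forall_true_left]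
      exact and_comm
    · rw [if_neg (by omega)]
      have h1 := numPresent_eq_sub_iff hbx (i := i) (k := k) (m := k - r) hu ht (by omega)
      rw [show k - (k - r) = r by omega] at h1
      have h2 : completion (fun j => B j x) i k u (k - r + 1) =
          completion (fun j => B j x) i k u (k - r) + B (i - r + 1) x := by
        simp only [completion]
        rw [← add_assoc, Finset.sum_Ioc_succ_top (by omega),
          show i - k + (k - r) + 1 = i - r + 1 by omega]
        ring
      rw [h1, h2]
      rcases hrk.lt_or_eq with h | h
      · rw [hb x h]
        constructor
        · rintro ⟨⟨h3, h4⟩, h5⟩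
          exact ⟨⟨fun _ => h5, h3⟩, by linarith⟩
        · rintro ⟨⟨h3, h4⟩, h5⟩
          exact ⟨⟨h4, by linarith⟩, h3 h⟩
      · subst h
        rw [Nat.sub_self, completion_zero]
        constructor
        · rintro ⟨⟨h3, h4⟩, h5⟩
          exact ⟨⟨fun h => absurd h (lt_irrefl _), h3⟩, by linarith⟩
        · rintro ⟨⟨h3, h4⟩, h5⟩
          exact ⟨⟨h4, by linarith⟩, by linarith⟩
  have hF : ∀ F : ℕ → ℝ → Ω → ℝ≥0∞,
      ∫⁻ x in {x | numPresent (fun j => B j x) i k u t = r} ∩ {x | u < B (i - k + 1) x},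
        F (nextState (fun j => B j x) i k u t).1 (nextState (fun j => B j x) i k u t).2 x ∂P =
      ∫⁻ x in {x | (truncSeq (Finset.Iic (i - r)) fun j => B j x) ∈ A ∧
        v (truncSeq (Finset.Iic (i - r)) fun j => B j x) < B (i - r + 1) x},
        F (r + 1) (v (truncSeq (Finset.Iic (i - r)) fun j => B j x)) x ∂P := by
    intro F
    rw [← Measure.restrict_congr_set hS]
    refine setLIntegral_congr_fun ((hms r).inter
      (measurableSet_lt measurable_const (hM.measurable _))) fun x hx => ?_
    have hx1 : numPresent (fun j => B j x) i k u t = r := hx.1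
    simp only [nextState, hx1, hv, hc]
  rw [hF fun k u x => ENNReal.ofReal (cost n w π (fun j => B j x) (i + 1) k u),
    hF fun k u _ => expectedCost P B n w π (i + 1) k u]
  exact setLIntegral_cost_frozen hM.measurable hM.indep (hrk.trans hk) hi hAm hvm rfl

end Markov

/-! ### Distributions of the completion times -/

section Distribution

variable {P : Measure Ω} {B : ℕ → Ω → ℝ} {μ : ℕ → ℝ} {n i k m ℓ a : ℕ} {u s t : ℝ}

lemma lintegral_expMeasure (r : ℝ) {F : ℝ → ℝ≥0∞} (hF : Measurable F) :
    ∫⁻ x, F x ∂(expMeasure r) = ∫⁻ x in Ici 0, ENNReal.ofReal (r * Real.exp (-(r * x))) * F x := by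
  have hp : Measurable (exponentialPDF r) := by
    unfold exponentialPDF
    fun_prop
  change ∫⁻ x, F x ∂(volume.withDensity (exponentialPDF r)) = _
  rw [lintegral_withDensity_eq_lintegral_mul _ hp hF, ← lintegral_indicator measurableSet_Ici]
  refine lintegral_congr fun x => ?_
  simp only [Pi.mul_apply, indicator, mem_Ici]
  split_ifs with h
  · rw [exponentialPDF_of_nonneg h]
  · rw [exponentialPDF_of_neg (not_le.1 h), zero_mul]

/-- Lack of memory of the exponential law. -/
lemma setLIntegral_Ioi_expMeasure {r : ℝ} (hu : 0 ≤ u) {F : ℝ → ℝ≥0∞}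
    (hF : Measurable F) :
    ∫⁻ x in Ioi u, F (x - u) ∂(expMeasure r) =
      ENNReal.ofReal (Real.exp (-(r * u))) * ∫⁻ x, F x ∂(expMeasure r) := by
  have hFu : Measurable fun x => F (x - u) := hF.comp (measurable_id.sub_const u)
  rw [← lintegral_indicator measurableSet_Ioi,
    lintegral_expMeasure r (hFu.indicator measurableSet_Ioi), lintegral_expMeasure r hF,
    ← lintegral_const_mul _ (by fun_prop), ← lintegral_indicator measurableSet_Ici,
    ← lintegral_add_right_eq_self _ u, ← restrict_Ioi_eq_restrict_Ici,
    ← lintegral_indicator measurableSet_Ioi]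
  refine lintegral_congr fun x => ?_
  simp only [indicator, mem_Ici, mem_Ioi, lt_add_iff_pos_left, add_sub_cancel_right]
  by_cases hx : 0 < x
  · rw [if_pos (by linarith), if_pos hx, if_pos hx, ← mul_assoc,
      ← ENNReal.ofReal_mul (Real.exp_pos _).le]
    congr 2
    rw [mul_add, neg_add, Real.exp_add]
    ring
  · simp [hx]

/-- Lack of memory, in the presence of an independent variable. -/
lemma setLIntegral_lt_exp [IsProbabilityMeasure P] {X Z : Ω → ℝ} {r : ℝ}
    (hX : Measurable X) (hZ : Measurable Z) (h : IndepFun X Z P) (hlaw : P.map X = expMeasure r)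
    (hu : 0 ≤ u) {F : ℝ × ℝ → ℝ≥0∞} (hF : Measurable F) :
    ∫⁻ x in {x | u < X x}, F (X x - u, Z x) ∂P =
      ENNReal.ofReal (Real.exp (-(r * u))) * ∫⁻ x, F (X x, Z x) ∂P := by
  have hm1 : Measurable fun v => ∫⁻ y, F (v, Z y) ∂P :=
    (hF.comp (measurable_fst.prodMk (hZ.comp measurable_snd))).lintegral_prod_right'
  have hm2 : Measurable fun v => ∫⁻ y, F (v - u, Z y) ∂P := hm1.comp (measurable_id.sub_const u)
  have hs : MeasurableSet {p : ℝ × ℝ | u < p.1} := measurableSet_lt measurable_const measurable_fst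
  have hF' : Measurable fun p : ℝ × ℝ => F (p.1 - u, p.2) :=
    hF.comp ((measurable_fst.sub_const u).prodMk measurable_snd)
  have h1 := lintegral_indepFun hX hZ h (hF'.indicator hs)
  rw [lintegral_indepFun hX hZ h hF, ← lintegral_map (f := fun v => ∫⁻ y, F (v, Z y) ∂P) hm1 hX,
    hlaw, ← setLIntegral_Ioi_expMeasure hu hm1, ← hlaw, ← lintegral_indicator measurableSet_Ioi,
    lintegral_map (hm2.indicator measurableSet_Ioi) hX,
    ← lintegral_indicator (measurableSet_lt measurable_const hX)]
  refine Eq.trans (lintegral_congr fun x => ?_) (h1.trans (lintegral_congr fun x => ?_))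
  · rfl
  · by_cases hx : u < X x
    · simp [indicator, hx]
    · simp [indicator, hx]

lemma measure_lt_exp [IsProbabilityMeasure P] {X : Ω → ℝ} {r : ℝ}
    (hX : Measurable X) (hlaw : P.map X = expMeasure r) (hu : 0 ≤ u) :
    P {x | u < X x} = ENNReal.ofReal (Real.exp (-(r * u))) := by
  have h := setLIntegral_lt_exp hX measurable_const (indepFun_const_right X (0 : ℝ)) hlaw hu
    (F := fun _ => 1) measurable_const
  simpa using h

lemma IsServiceModel.rate_pos (hM : IsServiceModel P n μ B) {j : ℕ} (h1 : 1 ≤ j) (h2 : j ≤ n) :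
    0 < μ j := hM.pos j (Finset.mem_Icc.2 ⟨h1, h2⟩)

lemma IsServiceModel.indepFun_sum (hM : IsServiceModel P n μ B) {S : Finset ℕ} {j : ℕ}
    (hj : j ∉ S) : IndepFun (fun x => ∑ i ∈ S, B i x) (B j) P := by
  have h := hM.indep.indepFun_finsetSum_of_notMem hM.measurable hj
  convert h using 1
  funext x
  simp

lemma IsServiceModel.measurable_sum (hM : IsServiceModel P n μ B) (S : Finset ℕ) :
    Measurable fun x => ∑ i ∈ S, B i x :=
  Finset.measurable_sum _ fun j _ => hM.measurable j

/-- The distribution function of a sum of service times. -/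
theorem measureReal_sum_le [IsProbabilityMeasure P] (hM : IsServiceModel P n μ B) (ha : 1 ≤ a)
    (hm : a + m ≤ n + 1) (hs : 0 ≤ s) :
    P.real {x | ∑ j ∈ Finset.Ico a (a + m), B j x ≤ s} = 1 - phaseTail μ a m s := by
  induction m generalizing s with
  | zero => simp [phaseTail, hs]
  | succ m ih =>
    have hr := hM.rate_pos (j := a + m) (by omega) (by omega)
    set r := μ (a + m) with hrdef
    set S : Ω → ℝ := fun x => ∑ j ∈ Finset.Ico a (a + m), B j x with hS
    have hSm : Measurable S := hM.measurable_sum _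
    have hXm := hM.measurable (a + m)
    have hind : IndepFun (B (a + m)) S P := (hM.indepFun_sum (by simp)).symm
    have hset : {x | ∑ j ∈ Finset.Ico a (a + (m + 1)), B j x ≤ s} =
        {x | B (a + m) x + S x ≤ s} := by
      ext x
      simp only [mem_ofPred_eq, hS]
      rw [← add_assoc, Finset.sum_Ico_succ_top (by omega), add_comm]
    have hs1 : MeasurableSet {p : ℝ × ℝ | p.1 + p.2 ≤ s} :=
      measurableSet_le (measurable_fst.add measurable_snd) measurable_const
    have hF : Measurable ({p : ℝ × ℝ | p.1 + p.2 ≤ s}.indicator fun _ => (1 : ℝ≥0∞)) :=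
      measurable_const.indicator hs1
    have hG : Measurable fun v => P {y | v + S y ≤ s} :=
      measurable_measure_prodMk_left (measurableSet_le (measurable_fst.add (hSm.comp measurable_snd))
        measurable_const)
    -- Disintegration along the last service; the density is supported on x ≥ 0, and values x > s
    -- drop out in `h2` because the other services are nonnegative.
    have h1 : P {x | B (a + m) x + S x ≤ s} =
        ∫⁻ x in Ici 0, ENNReal.ofReal (r * Real.exp (-(r * x))) * P {y | x + S y ≤ s} := by
      rw [← lintegral_expMeasure r hG, ← hM.law (a + m) (Finset.mem_Icc.2 ⟨by omega, by omega⟩),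
        lintegral_map hG hXm]
      have h2 := lintegral_indepFun hXm hSm hind hF
      have h3 : MeasurableSet {x | B (a + m) x + S x ≤ s} :=
        measurableSet_le (hXm.add hSm) measurable_const
      rw [← lintegral_indicator_one h3]
      refine Eq.trans (lintegral_congr fun x => rfl) (h2.trans (lintegral_congr fun x => ?_))
      have h4 : MeasurableSet {y | B (a + m) x + S y ≤ s} :=
        measurableSet_le (hSm.const_add _) measurable_const
      rw [← lintegral_indicator_one h4]
      rfl
    have hSnn : ∀ y, 0 ≤ S y := fun y => Finset.sum_nonneg fun j _ => hM.nonneg j y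
    have h2 : ∫⁻ x in Ici 0, ENNReal.ofReal (r * Real.exp (-(r * x))) * P {y | x + S y ≤ s} =
        ∫⁻ x in Icc 0 s, ENNReal.ofReal
          (r * Real.exp (-(r * x)) * (1 - phaseTail μ a m (s - x))) := by
      rw [← lintegral_indicator measurableSet_Ici, ← lintegral_indicator measurableSet_Icc]
      refine lintegral_congr fun x => ?_
      by_cases hx : x ∈ Icc 0 s
      · rw [indicator_of_mem hx, indicator_of_mem (mem_Ici.2 hx.1),
          ENNReal.ofReal_mul (mul_pos hr (Real.exp_pos _)).le, ← ih (by omega) (sub_nonneg.2 hx.2),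
          ofReal_measureReal]
        congr 2
        ext y
        change x + S y ≤ s ↔ S y ≤ s - x
        constructor <;> intro h <;> linarith
      · rw [indicator_of_notMem hx]
        refine indicator_apply_eq_zero.2 fun hx0 => ?_
        have : {y | x + S y ≤ s} = ∅ := eq_empty_of_forall_notMem fun y hy =>
          hx ⟨hx0, le_trans (le_add_of_nonneg_right (hSnn y)) hy⟩
        rw [this, measure_empty, mul_zero]
    have hnn : ∀ x ∈ Icc 0 s, 0 ≤ r * Real.exp (-(r * x)) * (1 - phaseTail μ a m (s - x)) := by
      intro x hx
      rw [← ih (by omega) (sub_nonneg.2 hx.2)]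
      exact mul_nonneg (mul_pos hr (Real.exp_pos _)).le measureReal_nonneg
    have hcont : Continuous fun x => r * Real.exp (-(r * x)) * (1 - phaseTail μ a m (s - x)) := by
      have := continuous_phaseTail μ a m
      fun_prop
    rw [hset, measureReal_def, h1, h2, ← ofReal_integral_eq_lintegral_ofReal
      (hcont.continuousOn.integrableOn_compact isCompact_Icc)
      ((ae_restrict_iff' measurableSet_Icc).2 (Eventually.of_forall hnn)),
      integral_Icc_eq_integral_Ioc, ← intervalIntegral.integral_of_le hs,
      ENNReal.toReal_ofReal (intervalIntegral.integral_nonneg hs hnn),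
      integral_exp_mul_phaseTail hM.pos hM.distinct ha (by omega)]

/-- The distribution function agrees with 1 minus `phaseTail` only on [0, ∞), so the derivative is
taken within that set. -/
theorem hasDerivWithinAt_hypoexpCDF [IsProbabilityMeasure P] (hM : IsServiceModel P n μ B)
    (hk : 1 ≤ k) (hℓ : k + ℓ ≤ n) (hs : 0 ≤ s) :
    HasDerivWithinAt (hypoexpCDF P B k ℓ)
      (∑ j ∈ Finset.Icc k (k + ℓ), hypoexpCoeff μ k ℓ j * Real.exp (-μ j * s)) (Ici 0) s := by
  have h := ((hasDerivAt_phaseTail hM.pos hM.distinct hk hℓ s).const_sub 1).hasDerivWithinAt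
    (s := Ici 0)
  rw [neg_neg] at h
  have heq : ∀ x ∈ Ici (0 : ℝ), hypoexpCDF P B k ℓ x = 1 - phaseTail μ k (ℓ + 1) x := by
    intro x hx
    rw [← measureReal_sum_le hM hk (by omega) hx, hypoexpCDF]
    rfl
  exact h.congr heq (heq s hs)

theorem hypoexpDensity_eq [IsProbabilityMeasure P] (hM : IsServiceModel P n μ B)
    (hk : 1 ≤ k) (hℓ : k + ℓ ≤ n) (hs : 0 ≤ s) :
    hypoexpDensity P B k ℓ s =
      ∑ j ∈ Finset.Icc k (k + ℓ), hypoexpCoeff μ k ℓ j * Real.exp (-μ j * s) :=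
  (hasDerivWithinAt_hypoexpCDF hM hk hℓ hs).derivWithin (uniqueDiffOn_Ici 0 s hs)

lemma measure_lt_ne_zero [IsProbabilityMeasure P] (hM : IsServiceModel P n μ B) (hk1 : 1 ≤ k)
    (hk : k ≤ i) (hi : i ≤ n) (hu : 0 ≤ u) : P {x | u < B (i - k + 1) x} ≠ 0 := by
  have hj : i - k + 1 ∈ Finset.Icc 1 n := Finset.mem_Icc.2 ⟨by omega, by omega⟩
  rw [measure_lt_exp (hM.measurable _) (hM.law _ hj) hu]
  simp [Real.exp_pos]

lemma isProbabilityMeasure_stateLaw [IsProbabilityMeasure P] (hM : IsServiceModel P n μ B)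
    (hk1 : 1 ≤ k) (hk : k ≤ i) (hi : i ≤ n) (hu : 0 ≤ u) :
    IsProbabilityMeasure (stateLaw P B i k u) :=
  cond_isProbabilityMeasure (measure_lt_ne_zero hM hk1 hk hi hu)

lemma measurable_completion_comp (hM : IsServiceModel P n μ B) :
    Measurable fun x => completion (fun j => B j x) i k u m :=
  (hM.measurable_sum _).sub_const u

/-- The completion times given the state are distributed as from a fresh start. -/
theorem stateLaw_completion_le [IsProbabilityMeasure P] (hM : IsServiceModel P n μ B)
    (hk : k ≤ i) (hi : i ≤ n) (hu : 0 ≤ u) (hm1 : 1 ≤ m) (hm : m ≤ k) (hs : 0 ≤ s) :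
    (stateLaw P B i k u).real {x | completion (fun j => B j x) i k u m ≤ s} =
      1 - phaseTail μ (i - k + 1) m s := by
  obtain ⟨c, hc⟩ : ∃ c, i - k = c := ⟨_, rfl⟩
  -- As m ≥ 1, the conditioned service occurs in the sum and can be separated from the independent
  -- rest `Z`; `setLIntegral_lt_exp` then replaces B - u by a fresh B.
  obtain ⟨e, rfl⟩ : ∃ e, m = e + 1 := ⟨m - 1, by omega⟩
  have hj : c + 1 ∈ Finset.Icc 1 n := Finset.mem_Icc.2 ⟨by omega, by omega⟩
  set Z : Ω → ℝ := fun x => ∑ j ∈ Finset.Ico (c + 2) (c + 1 + (e + 1)), B j x with hZ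
  have hsum : ∀ x, ∑ j ∈ Finset.Ico (c + 1) (c + 1 + (e + 1)), B j x = B (c + 1) x + Z x :=
    fun x => Finset.sum_eq_sum_Ico_succ_bot (by omega) _
  have hZm : Measurable Z := hM.measurable_sum _
  have hind : IndepFun (B (c + 1)) Z P := (hM.indepFun_sum (by simp)).symm
  have hcomp : ∀ x, completion (fun j => B j x) i k u (e + 1) = B (c + 1) x - u + Z x := by
    intro x
    rw [completion, hc, ← add_sub_right_comm, ← hsum]
    congr 1
    refine Finset.sum_congr ?_ fun _ _ => rfl
    ext j
    simp only [Finset.mem_Ioc, Finset.mem_Ico]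
    omega
  have hXm := hM.measurable (c + 1)
  have hs1 : MeasurableSet {p : ℝ × ℝ | p.1 + p.2 ≤ s} :=
    measurableSet_le (measurable_fst.add measurable_snd) measurable_const
  have h1 := setLIntegral_lt_exp hXm hZm hind (hM.law _ hj) hu
    (F := {p : ℝ × ℝ | p.1 + p.2 ≤ s}.indicator fun _ => 1) (measurable_const.indicator hs1)
  have hA : MeasurableSet {x | B (c + 1) x - u + Z x ≤ s} :=
    measurableSet_le ((hXm.sub_const u).add hZm) measurable_const
  have hA' : MeasurableSet {x | B (c + 1) x + Z x ≤ s} :=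
    measurableSet_le (hXm.add hZm) measurable_const
  have h2 : ∫⁻ x in {x | u < B (c + 1) x}, {p : ℝ × ℝ | p.1 + p.2 ≤ s}.indicator (fun _ => 1)
      (B (c + 1) x - u, Z x) ∂P = P ({x | u < B (c + 1) x} ∩ {x | B (c + 1) x - u + Z x ≤ s}) := by
    rw [inter_comm, ← Measure.restrict_apply hA, ← lintegral_indicator_one hA]
    rfl
  have h3 : ∫⁻ x, {p : ℝ × ℝ | p.1 + p.2 ≤ s}.indicator (fun _ => 1) (B (c + 1) x, Z x) ∂P =
      P {x | B (c + 1) x + Z x ≤ s} := by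
    rw [← lintegral_indicator_one hA']
    rfl
  have h4 := measure_lt_exp hXm (hM.law _ hj) hu
  rw [h2, h3, ← h4] at h1
  have h5 := measure_lt_ne_zero hM (hm1.trans hm) hk hi hu
  rw [hc] at h5
  rw [← measureReal_sum_le hM (by omega) (by omega) hs]
  simp only [hcomp, hc, hsum]
  rw [measureReal_def, measureReal_def, stateLaw, hc,
    cond_apply (measurableSet_lt measurable_const hXm), h1, ← mul_assoc,
    ENNReal.inv_mul_cancel h5 (measure_ne_top _ _), one_mul]

theorem stateLaw_completion_le' [IsProbabilityMeasure P] (hM : IsServiceModel P n μ B)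
    (hk1 : 1 ≤ k) (hk : k ≤ i) (hi : i ≤ n) (hu : 0 ≤ u) (hm : m ≤ k) (hs : 0 ≤ s) :
    (stateLaw P B i k u).real {x | completion (fun j => B j x) i k u m ≤ s} =
      1 - phaseTail μ (i - k + 1) m s := by
  rcases Nat.eq_zero_or_pos m with rfl | h0
  · have := isProbabilityMeasure_stateLaw hM hk1 hk hi hu
    have h1 : -u ≤ s := by linarith
    simp [completion_zero, phaseTail, h1]
  · exact stateLaw_completion_le hM hk hi hu h0 hm hs

lemma stateLaw_lt_completion [IsProbabilityMeasure P] (hM : IsServiceModel P n μ B)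
    (hk1 : 1 ≤ k) (hk : k ≤ i) (hi : i ≤ n) (hu : 0 ≤ u) (hm : m ≤ k) (hs : 0 ≤ s) :
    (stateLaw P B i k u).real {x | s < completion (fun j => B j x) i k u m} =
      phaseTail μ (i - k + 1) m s := by
  have := isProbabilityMeasure_stateLaw hM hk1 hk hi hu
  have h1 : {x | s < completion (fun j => B j x) i k u m} =
      {x | completion (fun j => B j x) i k u m ≤ s}ᶜ := by
    ext x
    simp
  rw [h1, probReal_compl_eq_one_sub (measurableSet_le (measurable_completion_comp hM)
    measurable_const), stateLaw_completion_le' hM hk1 hk hi hu hm hs]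
  ring

theorem stateLaw_numPresent_eq_zero [IsProbabilityMeasure P] (hM : IsServiceModel P n μ B)
    (hk1 : 1 ≤ k) (hk : k ≤ i) (hi : i ≤ n) (hu : 0 ≤ u) (hs : 0 ≤ s) :
    (stateLaw P B i k u).real {x | numPresent (fun j => B j x) i k u s = 0} =
      1 - phaseTail μ (i - k + 1) k s := by
  rw [← stateLaw_completion_le hM hk hi hu hk1 le_rfl hs]
  congr 1
  ext x
  exact numPresent_eq_zero_iff (fun j => hM.nonneg j x) hk1

/-- Exactly m departures is a difference of nested completion events, and consecutive tails differ
by one phase probability. -/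
theorem stateLaw_numPresent_eq_sub [IsProbabilityMeasure P] (hM : IsServiceModel P n μ B)
    (hk : k ≤ i) (hi : i ≤ n) (hu : 0 ≤ u) (hm : m < k) (hs : 0 ≤ s) :
    (stateLaw P B i k u).real {x | numPresent (fun j => B j x) i k u s = k - m} =
      phaseProb μ (i - k + 1) m s := by
  have := isProbabilityMeasure_stateLaw hM (by omega) hk hi hu
  have h1 : {x | numPresent (fun j => B j x) i k u s = k - m} =
      {x | completion (fun j => B j x) i k u m ≤ s} \
        {x | completion (fun j => B j x) i k u (m + 1) ≤ s} := by
    ext x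
    simp only [mem_ofPred_eq, Set.mem_sdiff, not_le]
    exact numPresent_eq_sub_iff (fun j => hM.nonneg j x) hu hs hm
  have h2 : {x | completion (fun j => B j x) i k u (m + 1) ≤ s} ⊆
      {x | completion (fun j => B j x) i k u m ≤ s} := fun x hx =>
    (completion_mono (fun j => hM.nonneg j x) (Nat.le_succ m)).trans hx
  rw [h1, measureReal_sdiff h2 (measurableSet_le (measurable_completion_comp hM) measurable_const),
    stateLaw_completion_le' hM (by omega) hk hi hu hm.le hs,
    stateLaw_completion_le hM hk hi hu (by omega) hm hs, phaseTail_succ]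
  ring

theorem transProb_eq [IsProbabilityMeasure P] (hM : IsServiceModel P n μ B)
    (hk : k ≤ i) (hi : i ≤ n) (hu : 0 ≤ u) (ht : 0 ≤ t) (hm : m < k) :
    transProb P B i k (k + 1 - m) u t = phaseProb μ (i - k + 1) m t := by
  rw [← stateLaw_numPresent_eq_sub hM hk hi hu hm ht, transProb]
  congr 1
  ext x
  simp only [nextState, mem_ofPred_eq]
  omega

theorem transProb_one [IsProbabilityMeasure P] (hM : IsServiceModel P n μ B) (hk1 : 1 ≤ k)
    (hk : k ≤ i) (hi : i ≤ n) (hu : 0 ≤ u) (ht : 0 ≤ t) :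
    transProb P B i k 1 u t = 1 - phaseTail μ (i - k + 1) k t := by
  rw [← stateLaw_numPresent_eq_zero hM hk1 hk hi hu ht, transProb]
  simp [nextState]

lemma sum_transProb [IsProbabilityMeasure P] (hM : IsServiceModel P n μ B)
    (hk : k ≤ i) (hi : i ≤ n) (hu : 0 ≤ u) (ht : 0 ≤ t) :
    ∑ ℓ ∈ Finset.Icc 2 (k + 1), transProb P B i k ℓ u t = phaseTail μ (i - k + 1) k t := by
  rw [phaseTail]
  refine Finset.sum_bij' (fun ℓ _ => k + 1 - ℓ) (fun m _ => k + 1 - m) ?_ ?_ ?_ ?_ ?_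
  · intro ℓ hℓ
    simp only [Finset.mem_Icc, Finset.mem_range] at hℓ ⊢
    omega
  · intro ℓ hℓ
    simp only [Finset.mem_Icc, Finset.mem_range] at hℓ ⊢
    omega
  · intro ℓ hℓ
    simp only [Finset.mem_Icc] at hℓ
    omega
  · intro ℓ hℓ
    simp only [Finset.mem_range] at hℓ
    omega
  · intro ℓ hℓ
    simp only [Finset.mem_Icc] at hℓ
    rw [← transProb_eq hM hk hi hu ht (m := k + 1 - ℓ) (by omega),
      show k + 1 - (k + 1 - ℓ) = ℓ by omega]

end Distribution

/-! ### The idle term and the waiting term -/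

section Terms

variable {P : Measure Ω} {B : ℕ → Ω → ℝ} {μ : ℕ → ℝ} {n i k m ℓ a : ℕ} {u s t w : ℝ}

/-- Layer-cake formula; for 0 < s < t neither truncation affects the event that the variable exceeds
s. -/
lemma integral_min_max {Q : Measure Ω} [IsProbabilityMeasure Q] {S : Ω → ℝ} (hS : Measurable S)
    (ht : 0 ≤ t) :
    ∫ x, min (max 0 (S x)) t ∂Q = ∫ s in (0 : ℝ)..t, Q.real {x | s < S x} := by
  have hm : Measurable fun x => min (max 0 (S x)) t := (measurable_const.max hS).min measurable_const
  have hnn : ∀ x, 0 ≤ min (max 0 (S x)) t := fun x => le_min (le_max_left _ _) ht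
  have hint : Integrable (fun x => min (max 0 (S x)) t) Q :=
    Integrable.of_bound hm.aestronglyMeasurable t (Eventually.of_forall fun x => by
      rw [Real.norm_of_nonneg (hnn x)]
      exact min_le_right _ _)
  rw [hint.integral_eq_integral_meas_lt (Eventually.of_forall hnn),
    intervalIntegral.integral_of_le ht, integral_Ioc_eq_integral_Ioo,
    ← integral_indicator measurableSet_Ioi, ← integral_indicator measurableSet_Ioo]
  refine integral_congr_ae (Eventually.of_forall fun s => ?_)
  simp only [indicator, mem_Ioi, mem_Ioo]
  by_cases hs : 0 < s
  · by_cases hst : s < t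
    · rw [if_pos hs, if_pos ⟨hs, hst⟩]
      congr 1
      ext x
      simp [hst, hs.not_gt]
    · rw [if_pos hs, if_neg fun h => hst h.2]
      have : {x | s < min (max 0 (S x)) t} = ∅ := eq_empty_of_forall_notMem fun x hx =>
        hst (hx.trans_le (min_le_right _ _))
      rw [this, measureReal_empty]
  · rw [if_neg hs, if_neg fun h => hs h.1]

lemma integrable_min_max {Q : Measure Ω} [IsProbabilityMeasure Q] {S : Ω → ℝ} (hS : Measurable S)
    (ht : 0 ≤ t) : Integrable (fun x => min (max 0 (S x)) t) Q :=
  Integrable.of_bound ((measurable_const.max hS).min measurable_const).aestronglyMeasurable t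
    (Eventually.of_forall fun x => by
      rw [Real.norm_of_nonneg (le_min (le_max_left _ _) ht)]
      exact min_le_right _ _)

lemma idleTerm_eq_integral [IsProbabilityMeasure P] (hM : IsServiceModel P n μ B) (hk1 : 1 ≤ k)
    (hk : k ≤ i) (hi : i ≤ n) (hu : 0 ≤ u) (ht : 0 ≤ t) :
    idleTerm P B i k u t = t - ∫ s in (0 : ℝ)..t, phaseTail μ (i - k + 1) k s := by
  have h1 : idleTerm P B i k u t = ∫ s in (0 : ℝ)..t, (1 - phaseTail μ (i - k + 1) k s) := by
    refine intervalIntegral.integral_congr fun s hs => ?_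
    rw [uIcc_of_le ht] at hs
    exact stateLaw_numPresent_eq_zero hM hk1 hk hi hu hs.1
  rw [h1, intervalIntegral.integral_sub (by simp)
    ((continuous_phaseTail _ _ _).intervalIntegrable _ _)]
  simp

lemma waitTerm_eq_integral [IsProbabilityMeasure P] (hM : IsServiceModel P n μ B)
    (hk : k ≤ i) (hi : i ≤ n) (hu : 0 ≤ u) (ht : 0 ≤ t) :
    waitTerm P B i k u t = ∑ ℓ ∈ Finset.range k, ((k : ℝ) - ℓ - 1) *
      ∫ s in (0 : ℝ)..t, phaseProb μ (i - k + 1) ℓ s := by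
  have h1 : waitTerm P B i k u t = ∫ s in (0 : ℝ)..t, ∑ ℓ ∈ Finset.range k,
      ((k : ℝ) - ℓ - 1) * phaseProb μ (i - k + 1) ℓ s := by
    refine intervalIntegral.integral_congr fun s hs => ?_
    rw [uIcc_of_le ht] at hs
    refine Finset.sum_congr rfl fun ℓ hℓ => ?_
    rw [stateLaw_numPresent_eq_sub hM hk hi hu (Finset.mem_range.1 hℓ) hs.1]
  rw [h1, intervalIntegral.integral_finsetSum]
  · exact Finset.sum_congr rfl fun ℓ _ => intervalIntegral.integral_const_mul _ _
  · exact fun ℓ _ => ((continuous_phaseProb _ _ _).const_mul _).intervalIntegrable _ _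

lemma integral_phaseProb (μ : ℕ → ℝ) (a ℓ : ℕ) (t : ℝ) :
    ∫ s in (0 : ℝ)..t, phaseProb μ a ℓ s =
      ∑ j ∈ Finset.Icc a (a + ℓ), hypoexpCoeff μ a ℓ j / μ (a + ℓ) * expInt (μ j) t := by
  unfold phaseProb
  rw [intervalIntegral.integral_div, intervalIntegral.integral_finsetSum, Finset.sum_div]
  · refine Finset.sum_congr rfl fun j _ => ?_
    rw [intervalIntegral.integral_const_mul, expInt]
    ring
  · exact fun j _ => Continuous.intervalIntegrable (by fun_prop) _ _

theorem idleTerm_eq [IsProbabilityMeasure P] (hM : IsServiceModel P n μ B) (hk1 : 1 ≤ k)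
    (hk : k ≤ i) (hi : i ≤ n) (hu : 0 ≤ u) (ht : 0 ≤ t) :
    idleTerm P B i k u t = t - ∑ j ∈ Finset.Icc (i - k + 1) i,
      hypoexpCoeff μ (i - k + 1) (k - 1) j / μ j * expInt (μ j) t := by
  rw [idleTerm_eq_integral hM hk1 hk hi hu ht]
  congr 1
  obtain ⟨e, rfl⟩ : ∃ e, k = e + 1 := ⟨k - 1, by omega⟩
  have h1 : phaseTail μ (i - (e + 1) + 1) (e + 1) = _ :=
    funext (phaseTail_eq hM.pos hM.distinct (by omega) (by omega))
  rw [h1, intervalIntegral.integral_finsetSum, show i - (e + 1) + 1 + e = i by omega]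
  · refine Finset.sum_congr rfl fun j _ => ?_
    rw [intervalIntegral.integral_const_mul, intervalIntegral.integral_div, expInt,
      Nat.add_sub_cancel]
    ring
  · exact fun j _ => Continuous.intervalIntegrable (by fun_prop) _ _

theorem waitTerm_eq [IsProbabilityMeasure P] (hM : IsServiceModel P n μ B)
    (hk : k ≤ i) (hi : i ≤ n) (hu : 0 ≤ u) (ht : 0 ≤ t) :
    waitTerm P B i k u t = ∑ ℓ ∈ Finset.range k, ((k : ℝ) - ℓ - 1) *
      ∑ j ∈ Finset.Icc (i - k + 1) (i - k + ℓ + 1),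
        hypoexpCoeff μ (i - k + 1) ℓ j / μ (i - k + ℓ + 1) * expInt (μ j) t := by
  rw [waitTerm_eq_integral hM hk hi hu ht]
  refine Finset.sum_congr rfl fun ℓ _ => ?_
  rw [integral_phaseProb, show i - k + 1 + ℓ = i - k + ℓ + 1 by omega]

/-- Each ψ_j(t) tends to 1/μ_j, and `sum_hypoexpCoeff_div` says that the weighted sum of these
limits is 1: the expected time spent in a phase is the inverse of its rate. -/
theorem tendsto_waitTerm [IsProbabilityMeasure P] (hM : IsServiceModel P n μ B)
    (hk : k ≤ i) (hi : i ≤ n) (hu : 0 ≤ u) :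
    Tendsto (waitTerm P B i k u) atTop
      (𝓝 (∑ ℓ ∈ Finset.range k, ((k : ℝ) - ℓ - 1) * (1 / μ (i - k + ℓ + 1)))) := by
  have h1 : ∀ᶠ t in atTop, ∑ ℓ ∈ Finset.range k, ((k : ℝ) - ℓ - 1) *
      ∑ j ∈ Finset.Icc (i - k + 1) (i - k + ℓ + 1),
        hypoexpCoeff μ (i - k + 1) ℓ j / μ (i - k + ℓ + 1) * expInt (μ j) t =
      waitTerm P B i k u t := by
    filter_upwards [eventually_ge_atTop (0 : ℝ)] with t ht
    exact (waitTerm_eq hM hk hi hu ht).symm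
  refine Tendsto.congr' h1 (tendsto_finsetSum _ fun ℓ hℓ => Tendsto.const_mul _ ?_)
  have hℓ' := Finset.mem_range.1 hℓ
  have h2 : 1 / μ (i - k + ℓ + 1) = ∑ j ∈ Finset.Icc (i - k + 1) (i - k + ℓ + 1),
      hypoexpCoeff μ (i - k + 1) ℓ j / μ (i - k + ℓ + 1) * (1 / μ j) := by
    have h3 := sum_hypoexpCoeff_div hM.pos hM.distinct (a := i - k + 1) (ℓ := ℓ) (by omega) (by omega)
    rw [show i - k + 1 + ℓ = i - k + ℓ + 1 by omega] at h3
    conv_lhs => rw [← h3, Finset.sum_div]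
    exact Finset.sum_congr rfl fun j _ => by ring
  rw [h2]
  refine tendsto_finsetSum _ fun j hj => Tendsto.const_mul _ ?_
  have hj' := Finset.mem_Icc.1 hj
  have hr : 0 < μ j := hM.rate_pos (by omega) (by omega)
  have h4 : Tendsto (fun t => Real.exp (-μ j * t)) atTop (𝓝 0) :=
    Real.tendsto_exp_atBot.comp (tendsto_id.const_mul_atTop_of_neg (neg_lt_zero.2 hr))
  have h5 := (h4.const_sub 1).div_const (μ j)
  rw [sub_zero] at h5
  exact h5.congr fun t => (expInt_eq hr.ne' t).symm

/-- Phase ℓ is counted in the tails m = ℓ+1, …, k-1, that is k-ℓ-1 times: one count for each client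
waiting behind the one in service. -/
lemma sum_phaseTail (μ : ℕ → ℝ) (a k : ℕ) (s : ℝ) :
    ∑ m ∈ Finset.range k, phaseTail μ a m s =
      ∑ ℓ ∈ Finset.range k, ((k : ℝ) - ℓ - 1) * phaseProb μ a ℓ s := by
  induction k with
  | zero => simp
  | succ k ih =>
    rw [Finset.sum_range_succ, ih, Finset.sum_range_succ, phaseTail, ← Finset.sum_add_distrib]
    push_cast
    rw [show (k : ℝ) + 1 - k - 1 = 0 by ring, zero_mul, add_zero]
    exact Finset.sum_congr rfl fun ℓ _ => by ring

lemma integrable_waitDuring [IsProbabilityMeasure P] (hM : IsServiceModel P n μ B) (hk1 : 1 ≤ k)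
    (hk : k ≤ i) (hi : i ≤ n) (hu : 0 ≤ u) (ht : 0 ≤ t) :
    Integrable (fun x => waitDuring (fun j => B j x) i k u t) (stateLaw P B i k u) := by
  have := isProbabilityMeasure_stateLaw hM hk1 hk hi hu
  exact integrable_finsetSum _ fun m _ => integrable_min_max (measurable_completion_comp hM) ht

/-- The m-th client waits as long as fewer than m-1 services are completed, so its expected wait in
[0, t] is the integral of the tail for m-1. -/
theorem integral_waitDuring [IsProbabilityMeasure P] (hM : IsServiceModel P n μ B) (hk1 : 1 ≤ k)
    (hk : k ≤ i) (hi : i ≤ n) (hu : 0 ≤ u) (ht : 0 ≤ t) :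
    ∫ x, waitDuring (fun j => B j x) i k u t ∂(stateLaw P B i k u) = waitTerm P B i k u t := by
  have := isProbabilityMeasure_stateLaw hM hk1 hk hi hu
  have hI : ∀ m ∈ Finset.Icc 1 k, Integrable
      (fun x => min (remainingWait (fun j => B j x) i k u m) t) (stateLaw P B i k u) :=
    fun m _ => integrable_min_max (measurable_completion_comp hM) ht
  unfold waitDuring
  rw [integral_finsetSum _ hI]
  have h1 : ∀ m ∈ Finset.Icc 1 k,
      ∫ x, min (remainingWait (fun j => B j x) i k u m) t ∂(stateLaw P B i k u) =
      ∫ s in (0 : ℝ)..t, phaseTail μ (i - k + 1) (m - 1) s := by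
    intro m hm
    have hm' := Finset.mem_Icc.1 hm
    refine (integral_min_max (measurable_completion_comp hM) ht).trans
      (intervalIntegral.integral_congr fun s hs => ?_)
    rw [uIcc_of_le ht] at hs
    exact stateLaw_lt_completion hM hk1 hk hi hu (by omega) hs.1
  rw [Finset.sum_congr rfl h1, waitTerm_eq_integral hM hk hi hu ht]
  have h2 : ∑ m ∈ Finset.Icc 1 k, ∫ s in (0 : ℝ)..t, phaseTail μ (i - k + 1) (m - 1) s =
      ∑ m ∈ Finset.range k, ∫ s in (0 : ℝ)..t, phaseTail μ (i - k + 1) m s := by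
    refine Finset.sum_nbij' (fun m => m - 1) (fun m => m + 1) ?_ ?_ ?_ ?_ fun _ _ => rfl <;>
    · intro m hm
      simp only [Finset.mem_Icc, Finset.mem_range] at hm ⊢
      omega
  rw [h2, ← intervalIntegral.integral_finsetSum fun m _ =>
    (continuous_phaseTail _ _ _).intervalIntegrable _ _]
  simp only [sum_phaseTail]
  rw [intervalIntegral.integral_finsetSum fun m _ =>
    ((continuous_phaseProb _ _ _).const_mul _).intervalIntegrable _ _]
  exact Finset.sum_congr rfl fun ℓ _ => intervalIntegral.integral_const_mul _ _

/-- Idle time is t minus busy time. Conditioning on B > u is what makes the last completion time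
nonnegative; otherwise the idle time could exceed t. -/
lemma idleTime_ae_eq [IsProbabilityMeasure P] (hM : IsServiceModel P n μ B) (hk1 : 1 ≤ k) :
    (fun x => idleTime (fun j => B j x) i k u t) =ᵐ[stateLaw P B i k u]
      fun x => t - min (max 0 (completion (fun j => B j x) i k u k)) t := by
  have h := ae_cond_mem (μ := P) (measurableSet_lt (measurable_const (a := u))
    (hM.measurable (i - k + 1)))
  filter_upwards [h] with x hx
  have h1 : 0 ≤ completion (fun j => B j x) i k u k := by
    refine le_trans ?_ (completion_mono (fun j => hM.nonneg j x) hk1)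
    have : u < B (i - k + 1) x := hx
    simp only [completion, Nat.Ioc_succ_singleton, Finset.sum_singleton]
    linarith
  rw [idleTime, max_eq_right h1]
  rcases le_total t (completion (fun j => B j x) i k u k) with h2 | h2
  · rw [min_eq_right h2, max_eq_left (by linarith), sub_self]
  · rw [min_eq_left h2, max_eq_right (by linarith)]

lemma integrable_idleTime [IsProbabilityMeasure P] (hM : IsServiceModel P n μ B) (hk1 : 1 ≤ k)
    (hk : k ≤ i) (hi : i ≤ n) (hu : 0 ≤ u) (ht : 0 ≤ t) :
    Integrable (fun x => idleTime (fun j => B j x) i k u t) (stateLaw P B i k u) := by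
  have := isProbabilityMeasure_stateLaw hM hk1 hk hi hu
  exact ((integrable_const t).sub (integrable_min_max (measurable_completion_comp hM) ht)).congr
    (idleTime_ae_eq hM hk1).symm

theorem integral_idleTime [IsProbabilityMeasure P] (hM : IsServiceModel P n μ B) (hk1 : 1 ≤ k)
    (hk : k ≤ i) (hi : i ≤ n) (hu : 0 ≤ u) (ht : 0 ≤ t) :
    ∫ x, idleTime (fun j => B j x) i k u t ∂(stateLaw P B i k u) = idleTerm P B i k u t := by
  have := isProbabilityMeasure_stateLaw hM hk1 hk hi hu
  rw [integral_congr_ae (idleTime_ae_eq hM hk1), integral_sub (integrable_const t)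
    (integrable_min_max (measurable_completion_comp hM) ht),
    integral_min_max (measurable_completion_comp hM) ht, idleTerm_eq_integral hM hk1 hk hi hu ht]
  have h1 : ∫ s in (0 : ℝ)..t, (stateLaw P B i k u).real
      {x | s < completion (fun j => B j x) i k u k} =
      ∫ s in (0 : ℝ)..t, phaseTail μ (i - k + 1) k s := by
    refine intervalIntegral.integral_congr fun s hs => ?_
    rw [uIcc_of_le ht] at hs
    exact stateLaw_lt_completion hM hk1 hk hi hu le_rfl hs.1
  rw [h1]
  simp

/-- Expected cost incurred between two arrivals. -/
theorem lintegral_stageCost [IsProbabilityMeasure P] (hM : IsServiceModel P n μ B)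
    (hw : w ∈ Icc (0 : ℝ) 1) (hk1 : 1 ≤ k)
    (hk : k ≤ i) (hi : i ≤ n) (hu : 0 ≤ u) (ht : 0 ≤ t) :
    ∫⁻ x, ENNReal.ofReal (w * idleTime (fun j => B j x) i k u t +
        (1 - w) * waitDuring (fun j => B j x) i k u t) ∂(stateLaw P B i k u) =
      ENNReal.ofReal (w * idleTerm P B i k u t + (1 - w) * waitTerm P B i k u t) := by
  have h1 := (integrable_idleTime hM hk1 hk hi hu ht).const_mul w
  have h2 := (integrable_waitDuring hM hk1 hk hi hu ht).const_mul (1 - w)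
  rw [← integral_idleTime hM hk1 hk hi hu ht, ← integral_waitDuring hM hk1 hk hi hu ht,
    ← integral_const_mul, ← integral_const_mul, ← integral_add h1 h2]
  exact (ofReal_integral_eq_lintegral_ofReal (h1.add h2) (Eventually.of_forall fun x =>
    add_nonneg (mul_nonneg hw.1 idleTime_nonneg)
      (mul_nonneg (sub_nonneg.2 hw.2) (waitDuring_nonneg ht)))).symm

/-- Expected cost incurred after the last arrival. -/
theorem expectedCost_last [IsProbabilityMeasure P] (hM : IsServiceModel P n μ B)
    (hw : w ∈ Icc (0 : ℝ) 1) (hk1 : 1 ≤ k) (hk : k ≤ n) (hu : 0 ≤ u) (π : Policy) :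
    expectedCost P B n w π n k u = ENNReal.ofReal ((1 - w) *
      ∑ ℓ ∈ Finset.range k, ((k : ℝ) - ℓ - 1) * (1 / μ (n - k + ℓ + 1))) := by
  have hmeas : ∀ N : ℕ, Measurable fun x => waitDuring (fun j => B j x) n k u N := fun N =>
    Finset.measurable_sum _ fun m _ =>
      (measurable_const.max (measurable_completion_comp hM)).min measurable_const
  have h1 : ∀ N : ℕ, ∫⁻ x, ENNReal.ofReal ((1 - w) * waitDuring (fun j => B j x) n k u N)
      ∂(stateLaw P B n k u) = ENNReal.ofReal ((1 - w) * waitTerm P B n k u N) := by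
    intro N
    have hN : (0 : ℝ) ≤ N := N.cast_nonneg
    rw [← integral_waitDuring hM hk1 hk le_rfl hu hN, ← integral_const_mul]
    exact (ofReal_integral_eq_lintegral_ofReal
      ((integrable_waitDuring hM hk1 hk le_rfl hu hN).const_mul _) (Eventually.of_forall fun x =>
        mul_nonneg (sub_nonneg.2 hw.2) (waitDuring_nonneg hN))).symm
  -- Monotone convergence: waits truncated at time N increase to the full waits, and on each path
  -- equal them once N is large.
  have h2 : Tendsto (fun N : ℕ => ∫⁻ x, ENNReal.ofReal ((1 - w) *
      waitDuring (fun j => B j x) n k u N) ∂(stateLaw P B n k u)) atTop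
      (𝓝 (expectedCost P B n w π n k u)) := by
    refine lintegral_tendsto_of_tendsto_of_monotone
      (fun N => ((hmeas N).const_mul _).ennreal_ofReal.aemeasurable)
      (Eventually.of_forall fun x N N' hNN => ENNReal.ofReal_le_ofReal
        (mul_le_mul_of_nonneg_left (Finset.sum_le_sum fun m _ => min_le_min le_rfl
          (Nat.cast_le.2 hNN)) (sub_nonneg.2 hw.2)))
      (Eventually.of_forall fun x => (ENNReal.continuous_ofReal.tendsto _).comp ?_)
    simp only [cost, Nat.sub_self, Finset.range_zero, Finset.sum_empty, mul_zero, zero_add,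
      Finset.Icc_eq_empty (show ¬ (1 : ℕ) ≤ 0 by omega), add_zero]
    refine Tendsto.const_mul _ (tendsto_finsetSum _ fun m _ => ?_)
    refine tendsto_const_nhds.congr' ?_
    filter_upwards [eventually_ge_atTop ⌈remainingWait (fun j => B j x) n k u m⌉₊] with N hN
    exact (min_eq_left ((Nat.le_ceil _).trans (Nat.cast_le.2 hN))).symm
  simp only [h1] at h2
  refine tendsto_nhds_unique h2 ((ENNReal.continuous_ofReal.tendsto _).comp (Tendsto.const_mul _ ?_))
  exact (tendsto_waitTerm hM hk le_rfl hu).comp tendsto_natCast_atTop_atTop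

end Terms

/-! ### Dynamic programming -/

/-- Expected cost from state `(k, u)` at the arrival of client `i` on, if client `i + 1` arrives
`t` time units later and the cost from then on is `V ℓ` when `ℓ` clients are present. -/
def bellmanValue (P : Measure Ω) (B : ℕ → Ω → ℝ) (w : ℝ) (i k : ℕ) (u : ℝ) (V : ℕ → ℝ) (t : ℝ) :
    ℝ :=
  w * idleTerm P B i k u t + (1 - w) * waitTerm P B i k u t +
    ∑ ℓ ∈ Finset.Icc 1 (k + 1), transProb P B i k ℓ u t * V ℓ

/-- The solution of the Bellman recursion, when `d` clients are still to arrive. -/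
def valueFn (P : Measure Ω) (μ : ℕ → ℝ) (B : ℕ → Ω → ℝ) (n : ℕ) (w : ℝ) : ℕ → ℕ → ℝ
  | 0, k => (1 - w) * ∑ ℓ ∈ Finset.range k, ((k : ℝ) - ℓ - 1) * (1 / μ (n - k + ℓ + 1))
  | d + 1, k => sInf (bellmanValue P B w (n - (d + 1)) k 0 (valueFn P μ B n w d) '' Ici 0)

section DynamicProgramming

variable {P : Measure Ω} {B : ℕ → Ω → ℝ} {μ : ℕ → ℝ} {n i k d : ℕ} {u s t w : ℝ} {π : Policy}

lemma nextState_snd_nonneg {b : ℕ → ℝ} (hb : ∀ j, 0 ≤ b j) (hu : 0 ≤ u) (ht : 0 ≤ t) :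
    0 ≤ (nextState b i k u t).2 := by
  simp only [nextState]
  split_ifs with h
  · exact le_rfl
  · rw [sub_nonneg]
    have hle : numPresent b i k u t ≤ k := numPresent_le
    rcases Nat.eq_zero_or_pos (k - numPresent b i k u t) with h0 | h0
    · rw [h0, completion_zero]
      linarith
    · rw [← not_lt, lt_completion_iff hb h0 (Nat.sub_le _ _)]
      omega

lemma IsServiceModel.measurable_seq (hM : IsServiceModel P n μ B) :
    Measurable fun x j => B j x :=
  measurable_pi_lambda _ hM.measurable

lemma measurable_nextState_comp (hM : IsServiceModel P n μ B) :
    Measurable fun x => nextState (fun j => B j x) i k u t :=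
  measurable_nextState.comp₂ hM.measurable_seq measurable_const (h := fun _ => (u, t))

/-- One step of the recursion for the expected cost of a schedule. -/
theorem expectedCost_succ [IsProbabilityMeasure P] (hM : IsServiceModel P n μ B)
    (hw : w ∈ Icc (0 : ℝ) 1) (hk1 : 1 ≤ k) (hk : k ≤ i) (hi : i < n) (hu : 0 ≤ u)
    (ht : (π.τ i k u : ℝ) = t) :
    expectedCost P B n w π i k u =
      ENNReal.ofReal (w * idleTerm P B i k u t + (1 - w) * waitTerm P B i k u t) +
      ∫⁻ x, expectedCost P B n w π (i + 1) (nextState (fun j => B j x) i k u t).1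
        (nextState (fun j => B j x) i k u t).2 ∂(stateLaw P B i k u) := by
  have ht0 : 0 ≤ t := ht ▸ NNReal.coe_nonneg _
  rw [← lintegral_cost_nextState hM hk1 hk hi hu ht0, ← lintegral_stageCost hM hw hk1 hk hi.le hu ht0,
    expectedCost, ← lintegral_add_left]
  · refine lintegral_congr fun x => ?_
    rw [cost_succ (fun j => hM.nonneg j x) hk hi hu, ht, ENNReal.ofReal_add
      (add_nonneg (mul_nonneg hw.1 idleTime_nonneg)
        (mul_nonneg (sub_nonneg.2 hw.2) (waitDuring_nonneg ht0))) (cost_nonneg hw)]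
  · have h1 : Measurable fun x => idleTime (fun j => B j x) i k u t :=
      measurable_const.max (measurable_const.sub (measurable_completion_comp hM))
    have h2 : Measurable fun x => waitDuring (fun j => B j x) i k u t :=
      Finset.measurable_sum _ fun m _ =>
        (measurable_const.max (measurable_completion_comp hM)).min measurable_const
    exact ((h1.const_mul w).add (h2.const_mul (1 - w))).ennreal_ofReal

lemma lintegral_nextState_fst [IsProbabilityMeasure P] (hM : IsServiceModel P n μ B) (hk1 : 1 ≤ k)
    (hk : k ≤ i) (hi : i ≤ n) (hu : 0 ≤ u) {V : ℕ → ℝ}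
    (hV : ∀ ℓ ∈ Finset.Icc 1 (k + 1), 0 ≤ V ℓ) :
    ∫⁻ x, ENNReal.ofReal (V (nextState (fun j => B j x) i k u t).1) ∂(stateLaw P B i k u) =
      ENNReal.ofReal (∑ ℓ ∈ Finset.Icc 1 (k + 1), transProb P B i k ℓ u t * V ℓ) := by
  have := isProbabilityMeasure_stateLaw hM hk1 hk hi hu
  have hms : ∀ ℓ : ℕ, MeasurableSet {x | (nextState (fun j => B j x) i k u t).1 = ℓ} := fun ℓ =>
    (measurable_nextState_comp hM).fst (measurableSet_singleton ℓ)
  have h1 : ∀ x, ENNReal.ofReal (V (nextState (fun j => B j x) i k u t).1) =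
      ∑ ℓ ∈ Finset.Icc 1 (k + 1), {x | (nextState (fun j => B j x) i k u t).1 = ℓ}.indicator
        (fun _ => ENNReal.ofReal (V ℓ)) x := by
    intro x
    rw [Finset.sum_eq_single (nextState (fun j => B j x) i k u t).1]
    · simp only [indicator, mem_ofPred_eq, if_true]
    · intro ℓ _ hne
      simp only [indicator, mem_ofPred_eq]
      exact if_neg hne.symm
    · intro hn
      exact absurd (Finset.mem_Icc.2 ⟨Nat.succ_le_succ (Nat.zero_le _), nextState_fst_le⟩) hn
  have h2 : ∀ ℓ ∈ Finset.Icc 1 (k + 1), 0 ≤ transProb P B i k ℓ u t * V ℓ := fun ℓ hℓ =>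
    mul_nonneg measureReal_nonneg (hV ℓ hℓ)
  simp_rw [h1]
  rw [lintegral_finsetSum _ fun ℓ _ => measurable_const.indicator (hms ℓ),
    ENNReal.ofReal_sum_of_nonneg h2]
  refine Finset.sum_congr rfl fun ℓ _ => ?_
  rw [lintegral_indicator_const (hms ℓ), transProb, ENNReal.ofReal_mul measureReal_nonneg,
    ofReal_measureReal, mul_comm]

lemma idleTerm_nonneg (ht : 0 ≤ t) : 0 ≤ idleTerm P B i k u t :=
  intervalIntegral.integral_nonneg ht fun _ _ => measureReal_nonneg

lemma waitTerm_nonneg (ht : 0 ≤ t) : 0 ≤ waitTerm P B i k u t :=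
  intervalIntegral.integral_nonneg ht fun _ _ => Finset.sum_nonneg fun ℓ hℓ => by
    have : ((ℓ + 1 : ℕ) : ℝ) ≤ k := Nat.cast_le.2 (Finset.mem_range.1 hℓ)
    push_cast at this
    exact mul_nonneg (by linarith) measureReal_nonneg

lemma stageCost_nonneg (hw : w ∈ Icc (0 : ℝ) 1) (ht : 0 ≤ t) :
    0 ≤ w * idleTerm P B i k u t + (1 - w) * waitTerm P B i k u t :=
  add_nonneg (mul_nonneg hw.1 (idleTerm_nonneg ht))
    (mul_nonneg (sub_nonneg.2 hw.2) (waitTerm_nonneg ht))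

lemma sum_transProb_mul_nonneg {V : ℕ → ℝ} (hV : ∀ ℓ ∈ Finset.Icc 1 (k + 1), 0 ≤ V ℓ) :
    0 ≤ ∑ ℓ ∈ Finset.Icc 1 (k + 1), transProb P B i k ℓ u t * V ℓ :=
  Finset.sum_nonneg fun ℓ hℓ => mul_nonneg measureReal_nonneg (hV ℓ hℓ)

lemma bellmanValue_nonneg (hw : w ∈ Icc (0 : ℝ) 1) {V : ℕ → ℝ}
    (hV : ∀ ℓ ∈ Finset.Icc 1 (k + 1), 0 ≤ V ℓ) (ht : 0 ≤ t) :
    0 ≤ bellmanValue P B w i k u V t :=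
  add_nonneg (stageCost_nonneg hw ht) (sum_transProb_mul_nonneg hV)

/-- By lack of memory, the elapsed service time is irrelevant. -/
lemma bellmanValue_eq [IsProbabilityMeasure P] (hM : IsServiceModel P n μ B) (hk1 : 1 ≤ k)
    (hk : k ≤ i) (hi : i ≤ n) (hu : 0 ≤ u) (ht : 0 ≤ t) (V : ℕ → ℝ) :
    bellmanValue P B w i k u V t = bellmanValue P B w i k 0 V t := by
  rw [bellmanValue, bellmanValue, idleTerm_eq hM hk1 hk hi hu ht, idleTerm_eq hM hk1 hk hi le_rfl ht,
    waitTerm_eq hM hk hi hu ht, waitTerm_eq hM hk hi le_rfl ht]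
  congr 1
  refine Finset.sum_congr rfl fun ℓ hℓ => ?_
  have hℓ' := Finset.mem_Icc.1 hℓ
  congr 1
  rcases eq_or_ne ℓ 1 with rfl | h1
  · rw [transProb_one hM hk1 hk hi hu ht, transProb_one hM hk1 hk hi le_rfl ht]
  · obtain ⟨m, rfl⟩ : ∃ m, ℓ = k + 1 - m := ⟨k + 1 - ℓ, by omega⟩
    rw [transProb_eq hM hk hi hu ht (by omega), transProb_eq hM hk hi le_rfl ht (by omega)]

lemma valueFn_nonneg (hM : IsServiceModel P n μ B) (hw : w ∈ Icc (0 : ℝ) 1)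
    (hk1 : 1 ≤ k) (hk : k + d ≤ n) : 0 ≤ valueFn P μ B n w d k := by
  induction d generalizing k with
  | zero =>
    refine mul_nonneg (sub_nonneg.2 hw.2) (Finset.sum_nonneg fun ℓ hℓ => ?_)
    have hℓ' := Finset.mem_range.1 hℓ
    have : ((ℓ + 1 : ℕ) : ℝ) ≤ k := Nat.cast_le.2 hℓ'
    push_cast at this
    have h2 := hM.rate_pos (j := n - k + ℓ + 1) (by omega) (by omega)
    exact mul_nonneg (by linarith) (one_div_nonneg.2 h2.le)
  | succ d ih =>
    refine Real.sInf_nonneg ?_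
    rintro _ ⟨t, ht, rfl⟩
    refine bellmanValue_nonneg hw (fun ℓ hℓ => ?_) ht
    have hℓ' := Finset.mem_Icc.1 hℓ
    exact ih hℓ'.1 (by omega)

lemma bddBelow_bellmanValue (hM : IsServiceModel P n μ B) (hw : w ∈ Icc (0 : ℝ) 1)
    (hk : k + (d + 1) ≤ n) :
    BddBelow (bellmanValue P B w i k u (valueFn P μ B n w d) '' Ici 0) := by
  refine ⟨0, ?_⟩
  rintro _ ⟨t, ht, rfl⟩
  refine bellmanValue_nonneg hw (fun ℓ hℓ => ?_) ht
  have hℓ' := Finset.mem_Icc.1 hℓ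
  exact valueFn_nonneg hM hw hℓ'.1 (by omega)

/-- No schedule does better than the solution of the Bellman recursion. -/
theorem valueFn_le_expectedCost [IsProbabilityMeasure P] (hM : IsServiceModel P n μ B)
    (hw : w ∈ Icc (0 : ℝ) 1) (π : Policy) (hd : i + d = n) (hk1 : 1 ≤ k) (hk : k ≤ i)
    (hu : 0 ≤ u) : ENNReal.ofReal (valueFn P μ B n w d k) ≤ expectedCost P B n w π i k u := by
  induction d generalizing i k u with
  | zero =>
    obtain rfl : i = n := by omega
    exact (expectedCost_last hM hw hk1 hk hu π).ge
  | succ d ih =>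
    obtain ⟨t, ht⟩ : ∃ t : ℝ, (π.τ i k u : ℝ) = t := ⟨_, rfl⟩
    have ht0 : 0 ≤ t := ht ▸ NNReal.coe_nonneg _
    have hV : ∀ ℓ ∈ Finset.Icc 1 (k + 1), 0 ≤ valueFn P μ B n w d ℓ := fun ℓ hℓ =>
      valueFn_nonneg hM hw (Finset.mem_Icc.1 hℓ).1 (by have := Finset.mem_Icc.1 hℓ; omega)
    rw [expectedCost_succ hM hw hk1 hk (by omega) hu ht]
    calc ENNReal.ofReal (valueFn P μ B n w (d + 1) k)
        ≤ ENNReal.ofReal (bellmanValue P B w i k u (valueFn P μ B n w d) t) := by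
          refine ENNReal.ofReal_le_ofReal ?_
          rw [bellmanValue_eq hM hk1 hk (by omega) hu ht0, valueFn, show n - (d + 1) = i by omega]
          exact csInf_le (bddBelow_bellmanValue hM hw (by omega)) ⟨t, ht0, rfl⟩
      _ = ENNReal.ofReal (w * idleTerm P B i k u t + (1 - w) * waitTerm P B i k u t) +
          ∫⁻ x, ENNReal.ofReal (valueFn P μ B n w d (nextState (fun j => B j x) i k u t).1)
            ∂(stateLaw P B i k u) := by
          rw [lintegral_nextState_fst hM hk1 hk (by omega) hu hV, bellmanValue, ENNReal.ofReal_add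
            (stageCost_nonneg hw ht0) (sum_transProb_mul_nonneg hV)]
      _ ≤ _ := by
          refine add_le_add le_rfl (lintegral_mono fun x => ?_)
          exact ih (by omega) (Nat.succ_le_succ (Nat.zero_le _))
            (nextState_fst_le.trans (Nat.succ_le_succ hk))
            (nextState_snd_nonneg (fun j => hM.nonneg j x) hu ht0)

/-- A schedule that almost attains the infimum in each step of the Bellman recursion. -/
theorem exists_policy_expectedCost_le [IsProbabilityMeasure P] (hM : IsServiceModel P n μ B)
    (hw : w ∈ Icc (0 : ℝ) 1) {ε : ℝ} (hε : 0 < ε) : ∃ π : Policy, ∀ d i k : ℕ, ∀ u : ℝ,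
      i + d = n → 1 ≤ k → k ≤ i → 0 ≤ u →
      expectedCost P B n w π i k u ≤ ENNReal.ofReal (valueFn P μ B n w d k + d * ε) := by
  -- The near-minimiser is chosen at elapsed time 0 and used for all u, which `bellmanValue_eq`
  -- permits. The schedule is then trivially measurable in u, and each stage loses at most ε.
  have hex : ∀ i k : ℕ, ∃ t : ℝ≥0, bellmanValue P B w i k 0 (valueFn P μ B n w (n - i - 1)) t <
      sInf (bellmanValue P B w i k 0 (valueFn P μ B n w (n - i - 1)) '' Ici 0) + ε := by
    intro i k
    obtain ⟨_, ⟨t, ht, rfl⟩, h⟩ := exists_lt_of_csInf_lt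
      (nonempty_Ici.image (bellmanValue P B w i k 0 (valueFn P μ B n w (n - i - 1))))
      (lt_add_of_pos_right _ hε)
    exact ⟨⟨t, ht⟩, h⟩
  choose τ hτ using hex
  refine ⟨⟨fun i k _ => τ i k, fun _ _ => measurable_const⟩, fun d => ?_⟩
  set π : Policy := ⟨fun i k _ => τ i k, fun _ _ => measurable_const⟩ with hπ
  induction d with
  | zero =>
    intro i k u hd hk1 hk hu
    obtain rfl : i = n := by omega
    rw [expectedCost_last hM hw hk1 hk hu π, Nat.cast_zero, zero_mul, add_zero, valueFn]
  | succ d ih =>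
    intro i k u hd hk1 hk hu
    have hV : ∀ ℓ ∈ Finset.Icc 1 (k + 1), 0 ≤ valueFn P μ B n w d ℓ := fun ℓ hℓ =>
      valueFn_nonneg hM hw (Finset.mem_Icc.1 hℓ).1 (by have := Finset.mem_Icc.1 hℓ; omega)
    have ht0 : (0 : ℝ) ≤ τ i k := NNReal.coe_nonneg _
    have := isProbabilityMeasure_stateLaw hM hk1 hk (by omega) hu
    have hdε : 0 ≤ (d : ℝ) * ε := by positivity
    rw [expectedCost_succ hM hw hk1 hk (by omega) hu (t := τ i k) rfl]
    calc _ ≤ ENNReal.ofReal (w * idleTerm P B i k u (τ i k) +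
            (1 - w) * waitTerm P B i k u (τ i k)) +
          ∫⁻ x, (ENNReal.ofReal (valueFn P μ B n w d
            (nextState (fun j => B j x) i k u (τ i k)).1) + ENNReal.ofReal (d * ε))
            ∂(stateLaw P B i k u) := by
          refine add_le_add le_rfl (lintegral_mono fun x => ?_)
          refine (ih _ _ _ (by omega) (Nat.succ_le_succ (Nat.zero_le _))
            (nextState_fst_le.trans (Nat.succ_le_succ hk))
            (nextState_snd_nonneg (fun j => hM.nonneg j x) hu ht0)).trans ?_
          exact ENNReal.ofReal_add_le
      _ = ENNReal.ofReal (bellmanValue P B w i k u (valueFn P μ B n w d) (τ i k) + d * ε) := by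
          rw [lintegral_add_right _ measurable_const, lintegral_const, measure_univ, mul_one,
            lintegral_nextState_fst hM hk1 hk (by omega) hu hV, ← add_assoc, ← ENNReal.ofReal_add
            (stageCost_nonneg hw ht0) (sum_transProb_mul_nonneg hV), ← ENNReal.ofReal_add
            (add_nonneg (stageCost_nonneg hw ht0) (sum_transProb_mul_nonneg hV)) hdε, bellmanValue]
      _ ≤ _ := by
          refine ENNReal.ofReal_le_ofReal ?_
          have h := (hτ i k).le
          rw [show n - i - 1 = d by omega] at h
          rw [bellmanValue_eq hM hk1 hk (by omega) hu ht0, valueFn, show n - (d + 1) = i by omega]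
          push_cast
          linarith

theorem costToGo_eq [IsProbabilityMeasure P] (hM : IsServiceModel P n μ B)
    (hw : w ∈ Icc (0 : ℝ) 1) (hd : i + d = n) (hk1 : 1 ≤ k) (hk : k ≤ i) (hu : 0 ≤ u) :
    costToGo P B n w i k u = ENNReal.ofReal (valueFn P μ B n w d k) := by
  refine le_antisymm (ENNReal.le_of_forall_pos_le_add fun ε hε _ => ?_)
    (le_iInf fun π => valueFn_le_expectedCost hM hw π hd hk1 hk hu)
  -- The d stages share the error; dividing by d + 1 also covers d = 0.
  have hd1 : (0 : ℝ) < d + 1 := by positivity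
  obtain ⟨π, hπ⟩ := exists_policy_expectedCost_le hM hw (ε := ε / (d + 1))
    (div_pos (NNReal.coe_pos.2 hε) hd1)
  refine (iInf_le _ π).trans ((hπ d i k u hd hk1 hk hu).trans ?_)
  refine ENNReal.ofReal_add_le.trans (add_le_add le_rfl ?_)
  rw [← ENNReal.ofReal_coe_nnreal]
  refine ENNReal.ofReal_le_ofReal ?_
  rw [mul_div_assoc', div_le_iff₀ hd1]
  nlinarith [NNReal.coe_nonneg ε]

theorem toReal_costToGo_eq [IsProbabilityMeasure P] (hM : IsServiceModel P n μ B)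
    (hw : w ∈ Icc (0 : ℝ) 1) (hd : i + d = n) (hk1 : 1 ≤ k) (hk : k ≤ i) (hu : 0 ≤ u) :
    (costToGo P B n w i k u).toReal = valueFn P μ B n w d k := by
  rw [costToGo_eq hM hw hd hk1 hk hu, ENNReal.toReal_ofReal (valueFn_nonneg hM hw hk1 (by omega))]

/-- The Bellman recursion for the cost-to-go. -/
theorem isGLB_bellmanValue [IsProbabilityMeasure P] (hM : IsServiceModel P n μ B)
    (hw : w ∈ Icc (0 : ℝ) 1) (hk1 : 1 ≤ k) (hk : k ≤ i) (hi : i < n) (hu : 0 ≤ u) :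
    IsGLB (bellmanValue P B w i k u (fun ℓ => (costToGo P B n w (i + 1) ℓ 0).toReal) '' Ici 0)
      (costToGo P B n w i k u).toReal := by
  obtain ⟨d, hd⟩ : ∃ d, i + (d + 1) = n := ⟨n - i - 1, by omega⟩
  rw [toReal_costToGo_eq hM hw hd hk1 hk hu, valueFn, show n - (d + 1) = i by omega]
  have h1 : bellmanValue P B w i k u (fun ℓ => (costToGo P B n w (i + 1) ℓ 0).toReal) '' Ici 0 =
      bellmanValue P B w i k 0 (valueFn P μ B n w d) '' Ici 0 := by
    refine image_congr fun t ht => ?_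
    rw [bellmanValue_eq hM hk1 hk hi.le hu ht, bellmanValue, bellmanValue]
    congr 1
    refine Finset.sum_congr rfl fun ℓ hℓ => ?_
    have hℓ' := Finset.mem_Icc.1 hℓ
    rw [toReal_costToGo_eq hM hw (d := d) (by omega) hℓ'.1 (by omega) le_rfl]
  rw [h1]
  exact isGLB_csInf (nonempty_Ici.image _) (bddBelow_bellmanValue hM hw (by omega))

end DynamicProgramming

/-! ### Modification of the service times on a null set -/

/-- The service times of the clients `1, …, n`, made nonnegative everywhere. -/
def clampedService (B : ℕ → Ω → ℝ) (n j : ℕ) (x : Ω) : ℝ :=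
  if j ∈ Finset.Icc 1 n then max (B j x) 0 else 0

/-- Preimages under a constant are empty or everything: an empty one makes both sides zero, and full
ones can be dropped from the intersection and the product. -/
lemma iIndepFun_extend_const {P : Measure Ω} [IsProbabilityMeasure P] {S : Finset ℕ}
    {X : ℕ → Ω → ℝ} (h : iIndepFun (fun j : S => X j) P) (h0 : ∀ j ∉ S, X j = fun _ => 0) :
    iIndepFun X P := by
  rw [iIndepFun_iff_measure_inter_preimage_eq_mul] at h ⊢
  intro T A hA
  have hsub : ∀ T' : Finset ℕ, (∀ j ∈ T', j ∈ S) →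
      (∀ j ∈ T', MeasurableSet (A j)) →
      P (⋂ j ∈ T', X j ⁻¹' A j) = ∏ j ∈ T', P (X j ⁻¹' A j) := by
    intro T' hT' hA'
    have h1 := h (T'.subtype (· ∈ S)) (sets := fun j => A j) fun j hj =>
      hA' j (Finset.mem_subtype.1 hj)
    have h2 : (⋂ j ∈ T'.subtype (· ∈ S), X j ⁻¹' A j) = ⋂ j ∈ T', X j ⁻¹' A j := by
      ext x
      simp only [mem_iInter, Finset.mem_subtype]
      exact ⟨fun hx j hj => hx ⟨j, hT' j hj⟩ hj, fun hx j hj => hx j hj⟩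
    rw [h2] at h1
    rw [h1]
    exact Finset.prod_subtype_of_mem (fun j => P (X j ⁻¹' A j)) hT'
  have hconst : ∀ j ∉ S, X j ⁻¹' A j = univ ∨ X j ⁻¹' A j = ∅ := by
    intro j hj
    rw [h0 j hj]
    by_cases h : (0 : ℝ) ∈ A j
    · exact Or.inl (eq_univ_of_forall fun _ => h)
    · exact Or.inr (eq_empty_of_forall_notMem fun _ hx => h hx)
  by_cases hE : ∃ j ∈ T, X j ⁻¹' A j = ∅
  · obtain ⟨j, hj, hje⟩ := hE
    rw [Finset.prod_eq_zero hj (by rw [hje, measure_empty])]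
    exact measure_mono_null (iInter₂_subset j hj) (by rw [hje, measure_empty])
  · push Not at hE
    have huniv : ∀ j ∈ T, j ∉ S → X j ⁻¹' A j = univ := fun j hj hjS =>
      (hconst j hjS).resolve_right (hE j hj).ne_empty
    have h1 := hsub (T.filter (· ∈ S)) (fun j hj => (Finset.mem_filter.1 hj).2)
      fun j hj => hA j (Finset.mem_filter.1 hj).1
    have h2 : (⋂ j ∈ T.filter (· ∈ S), X j ⁻¹' A j) = ⋂ j ∈ T, X j ⁻¹' A j := by
      ext x
      simp only [mem_iInter, Finset.mem_filter]
      refine ⟨fun hx j hj => ?_, fun hx j hj => hx j hj.1⟩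
      by_cases hjS : j ∈ S
      · exact hx j ⟨hj, hjS⟩
      · rw [huniv j hj hjS]
        trivial
    rw [← h2, h1]
    refine Finset.prod_subset (Finset.filter_subset _ _) fun j hj hj' => ?_
    rw [huniv j hj fun hjS => hj' (Finset.mem_filter.2 ⟨hj, hjS⟩), measure_univ]

section Clamp

variable {P : Measure Ω} {B B' : ℕ → Ω → ℝ} {μ : ℕ → ℝ} {n i k ℓ : ℕ} {u s t w : ℝ}

lemma clampedService_ae_eq (hpos : ∀ j ∈ Finset.Icc 1 n, 0 < μ j)
    (hmeas : ∀ j ∈ Finset.Icc 1 n, Measurable (B j))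
    (hlaw : ∀ j ∈ Finset.Icc 1 n, P.map (B j) = expMeasure (μ j)) :
    ∀ᵐ x ∂P, ∀ j ∈ Finset.Icc 1 n, clampedService B n j x = B j x := by
  rw [Finset.eventually_all]
  intro j hj
  filter_upwards [ae_pos_of_map_eq_expMeasure (hpos j hj) (hmeas j hj) (hlaw j hj)] with x hx
  rw [clampedService, if_pos hj, max_eq_left hx.le]

lemma isServiceModel_clampedService [IsProbabilityMeasure P]
    (hpos : ∀ j ∈ Finset.Icc 1 n, 0 < μ j)
    (hdist : ∀ j ∈ Finset.Icc 1 n, ∀ m ∈ Finset.Icc 1 n, μ j = μ m → j = m)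
    (hmeas : ∀ j ∈ Finset.Icc 1 n, Measurable (B j))
    (hlaw : ∀ j ∈ Finset.Icc 1 n, P.map (B j) = expMeasure (μ j))
    (hind : iIndepFun (fun j : Finset.Icc 1 n => B j) P) :
    IsServiceModel P n μ (clampedService B n) where
  pos := hpos
  distinct := hdist
  measurable j := by
    by_cases hj : j ∈ Finset.Icc 1 n
    · have : clampedService B n j = fun x => max (B j x) 0 := funext fun x => if_pos hj
      rw [this]
      exact (hmeas j hj).max measurable_const
    · have : clampedService B n j = fun _ => 0 := funext fun x => if_neg hj
      rw [this]
      exact measurable_const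
  nonneg j x := by
    unfold clampedService
    split_ifs
    · exact le_max_right _ _
    · exact le_rfl
  law j hj := by
    rw [← hlaw j hj]
    refine Measure.map_congr ?_
    filter_upwards [clampedService_ae_eq hpos hmeas hlaw] with x hx
    exact hx j hj
  indep := by
    refine iIndepFun_extend_const (S := Finset.Icc 1 n) ?_ fun j hj => funext fun x => if_neg hj
    have h := hind.comp (fun _ y => max y 0) fun _ => measurable_id.max measurable_const
    convert h using 1
    funext j x
    exact if_pos j.2

/-- For u ≥ 0, clamping at 0 does not change whether B exceeds u, so the conditioning events
coincide exactly, not just almost surely. -/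
lemma stateLaw_clampedService (hk1 : 1 ≤ k) (hk : k ≤ i) (hi : i ≤ n) (hu : 0 ≤ u) :
    stateLaw P (clampedService B n) i k u = stateLaw P B i k u := by
  have h1 : {x | u < clampedService B n (i - k + 1) x} = {x | u < B (i - k + 1) x} := by
    ext x
    change u < clampedService B n (i - k + 1) x ↔ u < B (i - k + 1) x
    rw [clampedService, if_pos (Finset.mem_Icc.2 ⟨by omega, by omega⟩), lt_max_iff,
      or_iff_left hu.not_gt]
  rw [stateLaw, h1, stateLaw]

variable (hae : ∀ᵐ x ∂P, ∀ j ∈ Finset.Icc 1 n, clampedService B n j x = B j x)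
include hae

lemma hypoexpCDF_clampedService (hk : 1 ≤ k) (hℓ : k + ℓ ≤ n) :
    hypoexpCDF P (clampedService B n) k ℓ = hypoexpCDF P B k ℓ := by
  funext s
  refine measureReal_congr ?_
  filter_upwards [hae] with x hx
  have h1 : ∑ j ∈ Finset.Icc k (k + ℓ), clampedService B n j x =
      ∑ j ∈ Finset.Icc k (k + ℓ), B j x := Finset.sum_congr rfl fun j hj => by
    have hj' := Finset.mem_Icc.1 hj
    exact hx j (Finset.mem_Icc.2 ⟨by omega, by omega⟩)
  exact congrArg (· ≤ s) h1

lemma ae_stateLaw_clampedService :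
    ∀ᵐ x ∂(stateLaw P B i k u), ∀ j ∈ Finset.Ioc (i - k) n, clampedService B n j x = B j x := by
  filter_upwards [cond_absolutelyContinuous.ae_le hae] with x hx j hj
  have hj' := Finset.mem_Ioc.1 hj
  exact hx j (Finset.mem_Icc.2 ⟨by omega, hj'.2⟩)

lemma stateLaw_real_numPresent_clampedService (hk1 : 1 ≤ k) (hk : k ≤ i) (hi : i ≤ n)
    (hu : 0 ≤ u) (p : ℕ → Prop) :
    (stateLaw P (clampedService B n) i k u).real
        {x | p (numPresent (fun j => clampedService B n j x) i k u s)} =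
      (stateLaw P B i k u).real {x | p (numPresent (fun j => B j x) i k u s)} := by
  rw [stateLaw_clampedService hk1 hk hi hu]
  refine measureReal_congr ?_
  filter_upwards [ae_stateLaw_clampedService hae] with x hx
  have h1 : numPresent (fun j => clampedService B n j x) i k u s =
      numPresent (fun j => B j x) i k u s :=
    numPresent_congr hk fun j hj => hx j (Finset.Ioc_subset_Ioc_right hi hj)
  exact congrArg p h1

lemma idleTerm_clampedService (hk1 : 1 ≤ k) (hk : k ≤ i) (hi : i ≤ n) (hu : 0 ≤ u) :
    idleTerm P (clampedService B n) i k u = idleTerm P B i k u := by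
  funext t
  unfold idleTerm
  congr 1
  funext s
  exact stateLaw_real_numPresent_clampedService hae hk1 hk hi hu (· = 0)

lemma waitTerm_clampedService (hk1 : 1 ≤ k) (hk : k ≤ i) (hi : i ≤ n) (hu : 0 ≤ u) :
    waitTerm P (clampedService B n) i k u = waitTerm P B i k u := by
  funext t
  unfold waitTerm
  congr 1
  funext s
  refine Finset.sum_congr rfl fun ℓ _ => ?_
  rw [stateLaw_real_numPresent_clampedService hae hk1 hk hi hu (· = k - ℓ)]

lemma transProb_clampedService (hk1 : 1 ≤ k) (hk : k ≤ i) (hi : i ≤ n) (hu : 0 ≤ u) :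
    transProb P (clampedService B n) i k ℓ u t = transProb P B i k ℓ u t :=
  stateLaw_real_numPresent_clampedService hae hk1 hk hi hu (· + 1 = ℓ)

lemma costToGo_clampedService (hk1 : 1 ≤ k) (hk : k ≤ i) (hi : i ≤ n) (hu : 0 ≤ u) :
    costToGo P (clampedService B n) n w i k u = costToGo P B n w i k u := by
  unfold costToGo
  rw [stateLaw_clampedService hk1 hk hi hu]
  refine iInf_congr fun π => lintegral_congr_ae ?_
  filter_upwards [ae_stateLaw_clampedService hae] with x hx
  rw [cost_congr hk hi hx]

end Clamp

end

end AppointmentScheduling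

/-! ### Assembly of the theorem for general service times -/

open AppointmentScheduling in
theorem mainTheorem3 {Ω : Type*} [MeasurableSpace Ω] (P : Measure Ω) [IsProbabilityMeasure P]
    (n : ℕ) (μ : ℕ → ℝ) (B : ℕ → Ω → ℝ) (w : ℝ)
    (hμ_pos : ∀ j ∈ Finset.Icc 1 n, 0 < μ j)
    (hμ_distinct : ∀ j ∈ Finset.Icc 1 n, ∀ m ∈ Finset.Icc 1 n, μ j = μ m → j = m)
    (hB_meas : ∀ j ∈ Finset.Icc 1 n, Measurable (B j))
    (hB_law : ∀ j ∈ Finset.Icc 1 n, P.map (B j) = expMeasure (μ j))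
    (hB_indep : iIndepFun (fun j : Finset.Icc 1 n => B j) P)
    (hw : w ∈ Set.Icc (0 : ℝ) 1) :
    -- the hypoexponential densities
    (∀ k ℓ : ℕ, 1 ≤ k → k + ℓ ≤ n → ∀ s : ℝ, 0 ≤ s →
      HasDerivWithinAt (hypoexpCDF P B k ℓ)
        (∑ j ∈ Finset.Icc k (k + ℓ), hypoexpCoeff μ k ℓ j * Real.exp (-μ j * s)) (Set.Ici 0) s) ∧
    (∀ i ∈ Finset.Icc 1 n, ∀ k ∈ Finset.Icc 1 i, ∀ u : ℝ, 0 ≤ u →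
      -- the idle term and the waiting term
      (∀ t : ℝ, 0 ≤ t →
        idleTerm P B i k u t = t - ∑ j ∈ Finset.Icc (i - k + 1) i,
            hypoexpCoeff μ (i - k + 1) (k - 1) j / μ j * expInt (μ j) t ∧
        waitTerm P B i k u t = ∑ ℓ ∈ Finset.range k, ((k : ℝ) - ℓ - 1) *
          ∑ j ∈ Finset.Icc (i - k + 1) (i - k + ℓ + 1),
            hypoexpCoeff μ (i - k + 1) ℓ j / μ (i - k + ℓ + 1) * expInt (μ j) t) ∧
      -- the cost-to-go is finite and does not depend on the elapsed service time
      costToGo P B n w i k u ≠ ⊤ ∧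
      costToGo P B n w i k u = costToGo P B n w i k 0) ∧
    (∀ i ∈ Finset.Ico 1 n, ∀ k ∈ Finset.Icc 1 i, ∀ u : ℝ, 0 ≤ u →
      -- the transition probabilities
      (∀ t : ℝ, 0 ≤ t →
        transProb P B i k 1 u t = 1 - ∑ ℓ ∈ Finset.Icc 2 (k + 1), transProb P B i k ℓ u t ∧
        ∀ ℓ ∈ Finset.Icc 2 (k + 1),
          transProb P B i k ℓ u t =
            hypoexpDensity P B (i - k + 1) (k + 1 - ℓ) t / μ (i + 2 - ℓ)) ∧
      -- the Bellman recursion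
      IsGLB ((fun t : ℝ => w * idleTerm P B i k u t + (1 - w) * waitTerm P B i k u t +
          ∑ ℓ ∈ Finset.Icc 1 (k + 1),
            transProb P B i k ℓ u t * (costToGo P B n w (i + 1) ℓ 0).toReal) '' Set.Ici 0)
        (costToGo P B n w i k u).toReal) ∧
    -- the terminal condition
    (∀ k ∈ Finset.Icc 1 n, ∀ u : ℝ, 0 ≤ u →
      Tendsto (waitTerm P B n k u) atTop
        (𝓝 (∑ ℓ ∈ Finset.range k, ((k : ℝ) - ℓ - 1) * (1 / μ (n - k + ℓ + 1)))) ∧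
      (costToGo P B n w n k u).toReal =
        (1 - w) * ∑ ℓ ∈ Finset.range k, ((k : ℝ) - ℓ - 1) * (1 / μ (n - k + ℓ + 1))) := by
  have hae := clampedService_ae_eq hμ_pos hB_meas hB_law
  have hM := isServiceModel_clampedService hμ_pos hμ_distinct hB_meas hB_law hB_indep
  refine ⟨?_, ?_, ?_, ?_⟩
  · intro k ℓ hk hℓ s hs
    rw [← hypoexpCDF_clampedService hae hk hℓ]
    exact hasDerivWithinAt_hypoexpCDF hM hk hℓ hs
  · intro i hi k hk u hu
    obtain ⟨hi1, hin⟩ := Finset.mem_Icc.1 hi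
    obtain ⟨hk1, hki⟩ := Finset.mem_Icc.1 hk
    obtain ⟨d, hd⟩ : ∃ d, i + d = n := ⟨n - i, by omega⟩
    refine ⟨fun t ht => ?_, ?_, ?_⟩
    · rw [← idleTerm_clampedService hae hk1 hki hin hu, ← waitTerm_clampedService hae hk1 hki hin hu]
      exact ⟨idleTerm_eq hM hk1 hki hin hu ht, waitTerm_eq hM hki hin hu ht⟩
    · rw [← costToGo_clampedService hae hk1 hki hin hu, costToGo_eq hM hw hd hk1 hki hu]
      exact ENNReal.ofReal_ne_top
    · rw [← costToGo_clampedService hae hk1 hki hin hu,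
        ← costToGo_clampedService hae hk1 hki hin le_rfl, costToGo_eq hM hw hd hk1 hki hu,
        costToGo_eq hM hw hd hk1 hki le_rfl]
  · intro i hi k hk u hu
    obtain ⟨hi1, hin⟩ := Finset.mem_Ico.1 hi
    obtain ⟨hk1, hki⟩ := Finset.mem_Icc.1 hk
    refine ⟨fun t ht => ?_, ?_⟩
    · simp only [← transProb_clampedService hae hk1 hki hin.le hu]
      refine ⟨?_, fun ℓ hℓ => ?_⟩
      · rw [transProb_one hM hk1 hki hin.le hu ht, sum_transProb hM hki hin.le hu ht]
      · obtain ⟨hℓ2, hℓk⟩ := Finset.mem_Icc.1 hℓ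
        obtain ⟨m, rfl⟩ : ∃ m, ℓ = k + 1 - m := ⟨k + 1 - ℓ, by omega⟩
        rw [transProb_eq hM hki hin.le hu ht (by omega), hypoexpDensity,
          show k + 1 - (k + 1 - m) = m by omega,
          ← hypoexpCDF_clampedService hae (by omega) (by omega)]
        have h := hypoexpDensity_eq hM (k := i - k + 1) (ℓ := m) (by omega) (by omega) ht
        rw [hypoexpDensity] at h
        rw [h, phaseProb, show i - k + 1 + m = i + 2 - (k + 1 - m) by omega]
    · have h := isGLB_bellmanValue hM hw hk1 hki hin hu
      rw [costToGo_clampedService hae hk1 hki hin.le hu] at h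
      convert h using 1
      refine Set.image_congr fun t _ => ?_
      rw [bellmanValue, idleTerm_clampedService hae hk1 hki hin.le hu,
        waitTerm_clampedService hae hk1 hki hin.le hu]
      congr 1
      refine Finset.sum_congr rfl fun ℓ hℓ => ?_
      have hℓ' := Finset.mem_Icc.1 hℓ
      rw [transProb_clampedService hae hk1 hki hin.le hu,
        costToGo_clampedService hae hℓ'.1 (by omega) (by omega) le_rfl]
  · intro k hk u hu
    obtain ⟨hk1, hkn⟩ := Finset.mem_Icc.1 hk
    rw [← waitTerm_clampedService hae hk1 hkn le_rfl hu,
      ← costToGo_clampedService hae hk1 hkn le_rfl hu,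
      toReal_costToGo_eq hM hw (d := 0) rfl hk1 hkn hu]
    exact ⟨tendsto_waitTerm hM hkn le_rfl hu, rfl⟩
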